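/- **Market.** Fix $T,x_0,s_0>0$, a complete probability space $(\Omega,\mathcal A,\mathbb P)$ and a right-continuous filtration $\mathbb G=(\mathcal G_t)_{t\ge 0}$ containing the $\mathbb P$-null sets. Let $W$ be a Brownian motion; $N(dt,dz)$ a Poisson random measure on $[0,\infty)\times\mathbb R_0$, $\mathbb R_0=\mathbb R\setminus\{0\}$, independent of $W$, with intensity $dt\,\nu(dz)$, $\nu$ $\sigma$-finite, $\int z^2\nu(dz)<\infty$, $\tilde N=N-\nu(dz)dt$; and $H$ a càdlàg counting process with $\mathbb E[H(T)]<\infty$, jumps of size at most $1$ on $[0,T]$, almost surely no common jumps with $N$ on $[0,T]$, and $\mathbb G$-predictable intensity measure $\Lambda$. The coefficients $\rho,\mu,\sigma,\kappa$ (processes) and $\theta(t,z)$ (random field) are measurable and càglàd (a.s.; for $\theta$, for $\nu$-a.e. $z$), $\theta>-1$ and $\kappa\ge-1$ almost everywhere, and $$\mathbb E\Big[\int_0^T\big(|\mu|+\sigma^2+\int_{\mathbb R_0}\theta^2\,\nu(dz)\big)ds+\int_0^T|\kappa|\,\Lambda(ds)\Big]<\infty .$$ None of them has to be $\mathbb G$-adapted.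 $\int_0^t\varphi\, d^-W$ denotes the forward integral, i.e. the limit of $\int_0^t\varphi(s)\frac{W(s+\epsilon)-W(s)}{\epsilon}ds$ as $\epsilon\to0^+$ in $L^1(\mathbb P)$ uniformly in $t\in[0,T]$. The forward integral $\int_0^{t}\int f\,\tilde N(d^-s,dz)$ is the $L^2(\mathbb P)$-limit of $\int_0^{t}\int_{U_m}f\,d\tilde N$, where $(U_m)$ is a fixed increasing sequence of compact sets with $\nu(U_m)<\infty$ and $\bigcup_m U_m=\mathbb R_0$. Assume $\sigma$ is forward integrable with respect to $W$, and $\theta,\ln(1+\theta)$ are forward integrable with respect to $\tilde N$. The stock is $$S_1(t)=s_0\prod_{s\le t,\,\Delta H(s)>0}(1+\kappa(s)\Delta H(s))\exp\Big\{\int_0^t(\mu-\tfrac12\sigma^2)ds+\int_0^t\sigma\, d^-W+\int_0^t\!\int_{\mathbb R_0}(\ln(1+\theta)-\theta)\nu(dz)ds+\int_0^t\!\int_{\mathbb R_0}\ln(1+\theta)\tilde N(d^-s,dz)\Big\},$$ and $\tau\le T$ is a $\mathbb G$-stopping time with $\tau\le\inf\{t\in[0,T]:S_1(t)=0\}$ almost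 surely. **Portfolios.** $\mathcal A_{\mathbb G}$ is the set of càglàd $\mathbb G$-adapted processes $\pi$ on $[0,T]$ such that: there is a constant $\epsilon_\pi>0$ with, almost surely, $\pi(t)\kappa(t)>-1+\epsilon_\pi$ and $\pi(t)\theta(t,z)>-1+\epsilon_\pi$ for all $t\in[0,T]$, $z\in\mathbb R_0$; $\mathbb E\int_0^T(|\mu-\rho||\pi|+\sigma^2\pi^2)ds<\infty$ and $\mathbb E\int_0^T\int_{\mathbb R_0}|\theta\pi|^2\nu(dz)ds<\infty$; $\pi\sigma$ is càglàd and forward integrable with respect to $W$; and $\pi\theta$, $\ln(1+\pi\theta)$, $\frac{\pi\theta}{1+\pi\theta}$ are càglàd and forward integrable with respect to $\tilde N$ (up to every $t\in[0,T]$ and up to $\tau$). For $\pi\in\mathcal A_{\mathbb G}$ the terminal wealth is $$X_\pi(T)=x_0\exp\Big\{\int_0^{\tau}\!\big[\rho+(\mu-\rho)\pi-\tfrac12\sigma^2\pi^2\big]ds+\int_0^{\tau}\!\!\int_{\mathbb R_0}\!\big[\ln(1+\pi\theta)-\pi\theta\big]\nu(dz)ds+\int_0^{\tau}\!\sigma\pi\,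 d^-W+\int_0^{\tau}\!\!\int_{\mathbb R_0}\!\ln(1+\pi\theta)\tilde N(d^-s,dz)+\int_0^{\tau}\!\ln(1+\kappa\pi)dH\Big\}\,e^{\int_\tau^T\rho\, ds}.$$ **Local maxima.** Let $U$ be a utility function on $(0,\infty)$. Call $\pi\in\mathcal A_{\mathbb G}$ a local maximum if for every bounded $\beta\in\mathcal A_{\mathbb G}$ there is $\delta_{\pi,\beta}>0$ with $\mathbb E[U(X_{\pi+y\beta}(T))]\le\mathbb E[U(X_\pi(T))]$ whenever $|y|<\delta_{\pi,\beta}$ and $\pi+y\beta\in\mathcal A_{\mathbb G}$ (an expectation whose positive and negative parts are both infinite is read as $-\infty$). **Assumptions.** Put $R_y=\frac{\beta\theta}{1+(\pi+y\beta)\theta}$, $$\Psi(y,\beta,\pi)=\int_0^\tau\beta\big[\mu-\rho-(\pi+y\beta)\sigma^2\big]ds+\int_0^\tau\!\!\int_{\mathbb R_0}\big[R_y-\beta\theta\big]\nu(dz)ds+\int_0^\tau\beta\sigma\, d^-W+\int_0^\tau\!\!\int_{\mathbb R_0}R_y\,\tilde N(d^-s,dz)+\int_0^\tau\frac{\beta\kappa}{1+\kappa(\pi+y\beta)}dH,$$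 $$\Psi_y(y,\beta,\pi)=-\int_0^\tau\beta^2\sigma^2ds-\int_0^\tau\!\!\int_{\mathbb R_0}R_y^2\,N(ds,dz)-\int_0^\tau\frac{\beta^2\kappa^2}{[1+(\pi+y\beta)\kappa]^2}dH .$$ * $A_{\text{u.i.}}$ holds for $\pi$ if $U(X_\pi(T))$ and $U'(X_\pi(T))X_\pi(T)$ are integrable, $\mathbb E[U'(X_\pi(T))X_\pi(T)]>0$, and for every bounded $\beta\in\mathcal A_{\mathbb G}$ there is $\delta>0$ such that for $|y|<\delta$ the perturbation $\pi+y\beta$ is in $\mathcal A_{\mathbb G}$ and $R_y$ is càglàd and forward integrable with respect to $\tilde N$ (up to every $t\in[0,T]$ and up to $\tau$), and the family $\{U'(X_{\pi+y\beta}(T))X_{\pi+y\beta}(T)|\Psi(y,\beta,\pi)|\}_{|y|<\delta}$ is uniformly integrable. * $A_{d^2}$ holds for $\pi$ if $U$ is twice differentiable, strictly increasing and concave on $(0,\infty)$, and for every bounded $\beta\in\mathcal A_{\mathbb G}$ there is $\delta>0$ such that for $|y|<\delta$ the same objects are well defined and the family $$\{U''(X_{\pi+y\beta}(T))X_{\pi+y\beta}^2(T)\Psi^2+U'(X_{\pi+y\beta}(T))X_{\pi+y\beta}(T)[\Psi^2+\Psi_y]\}_{|y|<\delta}$$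 is uniformly integrable, where $\Psi=\Psi(y,\beta,\pi)$ and $\Psi_y=\Psi_y(y,\beta,\pi)$. * Non-degeneracy: the coefficients $\sigma,\theta,\kappa$ do not vanish on the same time intervals, that is, if $S\le S'\le\tau$ are $\mathbb G$-stopping times and $\int_S^{S'}\sigma^2ds+\int_S^{S'}\int_{\mathbb R_0}\theta^2N(ds,dz)+\int_S^{S'}\kappa^2dH=0$ almost surely, then $S=S'$ almost surely. **Theorem.** Assume non-degeneracy. Let $A\subseteq\mathcal A_{\mathbb G}$ be a convex set of bounded portfolios such that $A_{\text{u.i.}}$ and $A_{d^2}$ hold for every $\pi\in A$, and suppose $xU''(x)+U'(x)\le0$ for all $x>0$. Then $A$ contains at most one local maximum, up to the values of the portfolio that do not influence the wealth: if $\pi_1,\pi_2\in A$ are local maxima, then almost surely $\pi_1(t)=\pi_2(t)$ for all $t\in(0,\tau]$. -/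

import Mathlib

open MeasureTheory ProbabilityTheory Filter Topology Set
open scoped NNReal ENNReal

noncomputable section

namespace ForwardMarket

/-- Lebesgue measure on the time axis `[0,∞)`. -/
def leb : Measure ℝ≥0 := (volume : Measure ℝ).comap ((↑) : ℝ≥0 → ℝ)

/-! ### Path properties -/

/-- A path is càglàd on `[0,T]`: left continuous on `(0,T]`, with finite right limits
on `[0,T)`. -/
def IsCaglad (T : ℝ≥0) (f : ℝ≥0 → ℝ) : Prop :=
  (∀ t, 0 < t → t ≤ T → ContinuousWithinAt f (Iio t) t) ∧
  ∀ t, t < T → ∃ l : ℝ, Tendsto f (𝓝[>] t) (𝓝 l)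

/-- The jump `f(t) - f(t-)` of a path. -/
def jump (f : ℝ≥0 → ℝ) (t : ℝ≥0) : ℝ := f t - Function.leftLim f t

/-- Integral over `(s,t]` of `g` against the jumps of a pure jump path `h` that has finitely
many jumps on bounded intervals. -/
def jumpInt (h g : ℝ≥0 → ℝ) (s t : ℝ≥0) : ℝ := ∑ᶠ r ∈ Ioc s t, g r * jump h r

/-! ### The driving noises -/

/-- `N` is a Poisson random measure with intensity measure `m`. -/
structure IsPoissonRandomMeasure {Ω E : Type*} [MeasurableSpace Ω] [MeasurableSpace E]
    (N : Ω → Measure E) (m : Measure E) (P : Measure Ω) : Prop where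
  measurable : Measurable N
  integer_valued : ∀ᵐ ω ∂P, ∀ B, MeasurableSet B → ∃ n : ℕ∞, N ω B = (n : ℝ≥0∞)
  law : ∀ B, MeasurableSet B → m B ≠ ∞ → ∀ n : ℕ,
    P {ω | N ω B = n} = poissonMeasure (m B).toNNReal {n}
  indep : ∀ (n : ℕ) (B : Fin n → Set E), (∀ i, MeasurableSet (B i)) →
    Pairwise (Function.onFun Disjoint B) → iIndepFun (fun i ω => N ω (B i)) P

/-- `H` is a càdlàg counting process on `[0,∞)`, with unit jumps on `[0,T]` and `E[H(T)] < ∞`. -/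
structure IsCountingProcess {Ω : Type*} [MeasurableSpace Ω]
    (H : ℝ≥0 → Ω → ℝ) (T : ℝ≥0) (P : Measure Ω) : Prop where
  measurable : ∀ t, Measurable (H t)
  zero : ∀ᵐ ω ∂P, H 0 ω = 0
  nat_valued : ∀ᵐ ω ∂P, ∀ t, ∃ n : ℕ, H t ω = n
  mono : ∀ᵐ ω ∂P, Monotone (H · ω)
  right_cont : ∀ᵐ ω ∂P, ∀ t, ContinuousWithinAt (H · ω) (Ioi t) t
  jump_le : ∀ᵐ ω ∂P, ∀ t ≤ T, jump (H · ω) t ≤ 1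
  integrable : Integrable (H T) P

/-- `Λ` is the `G`-predictable intensity measure (predictable compensator) of `H` on `[0,T]`. -/
structure IsPredictableIntensity {Ω : Type*} {mΩ : MeasurableSpace Ω}
    (G : Filtration ℝ≥0 mΩ) (H : ℝ≥0 → Ω → ℝ) (Λ : Ω → Measure ℝ≥0) (T : ℝ≥0)
    (P : Measure Ω) : Prop where
  measurable : Measurable Λ
  predictable : Measurable[G.predictable] fun p : ℝ≥0 × Ω => Λ p.2 (Ioc 0 (min p.1 T))
  compensates : ∀ f : ℝ≥0 → Ω → ℝ≥0∞, Measurable[G.predictable] (Function.uncurry f) →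
    ∀ t ≤ T,
      ∫⁻ ω, ∑' r : Ioc 0 t, f r ω * ENNReal.ofReal (jump (H · ω) r) ∂P
        = ∫⁻ ω, ∫⁻ r in Ioc 0 t, f r ω ∂(Λ ω) ∂P

/-! ### Forward integrals -/

/-- `I` is (a continuous version of) the forward integral process of `φ` with respect to `W`
over `[0,T]`: the `ε`-approximations converge to `I` in `L¹(P)`, uniformly on `[0,T]`. -/
def HasForwardIntegralW {Ω : Type*} [MeasurableSpace Ω] (P : Measure Ω) (W : ℝ≥0 → Ω → ℝ)
    (T : ℝ≥0) (φ I : ℝ≥0 → Ω → ℝ) : Prop :=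
  (∀ t ≤ T, AEStronglyMeasurable (I t) P) ∧
  (∀ᵐ ω ∂P, ContinuousOn (I · ω) (Icc 0 T)) ∧
  Tendsto
    (fun ε : ℝ≥0 => ∫⁻ ω, ⨆ t ∈ Icc 0 T,
      ‖(∫ s in Ioc 0 t, φ s ω * ((W (s + ε) ω - W s ω) / (ε : ℝ)) ∂leb) - I t ω‖ₑ ∂P)
    (𝓝[>] 0) (𝓝 0)

/-- `φ` is forward integrable with respect to `W` over `[0,T]`. -/
def ForwardIntegrableW {Ω : Type*} [MeasurableSpace Ω] (P : Measure Ω) (W : ℝ≥0 → Ω → ℝ)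
    (T : ℝ≥0) (φ : ℝ≥0 → Ω → ℝ) : Prop :=
  ∃ I, HasForwardIntegralW P W T φ I

open Classical in
/-- The forward integral process `∫₀ᵗ φ d⁻W`, `t ∈ [0,T]` (unique up to indistinguishability;
the value `0` is used when `φ` is not forward integrable). -/
def forwardIntW {Ω : Type*} [MeasurableSpace Ω] (P : Measure Ω) (W : ℝ≥0 → Ω → ℝ)
    (T : ℝ≥0) (φ : ℝ≥0 → Ω → ℝ) : ℝ≥0 → Ω → ℝ :=
  if h : ForwardIntegrableW P W T φ then h.choose else 0

/-- The pathwise integral of `f` over `(0,t] × V` against `N(ds,dz) - ν(dz) ds`. -/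
def compensatedInt {Ω : Type*} (N : Ω → Measure (ℝ≥0 × ℝ)) (ν : Measure ℝ)
    (f : ℝ≥0 → ℝ → Ω → ℝ) (V : Set ℝ) (t : ℝ≥0) (ω : Ω) : ℝ :=
  (∫ p in Ioc 0 t ×ˢ V, f p.1 p.2 ω ∂(N ω)) -
    ∫ p in Ioc 0 t ×ˢ V, f p.1 p.2 ω ∂(leb.prod ν)

/-- `J` is the forward integral of `f` with respect to the compensated Poisson random measure
up to the (deterministic or random) time `S`: the `L²(P)`-limit of the integrals over
`(0,S] × K m`, where `K m` exhausts `ℝ \ {0}`. -/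
def HasForwardIntegralN {Ω : Type*} [MeasurableSpace Ω] (P : Measure Ω)
    (N : Ω → Measure (ℝ≥0 × ℝ)) (ν : Measure ℝ) (K : ℕ → Set ℝ)
    (f : ℝ≥0 → ℝ → Ω → ℝ) (S : Ω → ℝ≥0) (J : Ω → ℝ) : Prop :=
  (∀ m, MemLp (fun ω => compensatedInt N ν f (K m) (S ω) ω) 2 P) ∧ MemLp J 2 P ∧
  Tendsto (fun m => eLpNorm (fun ω => compensatedInt N ν f (K m) (S ω) ω - J ω) 2 P)
    atTop (𝓝 0)

open Classical in
/-- The forward integral `∫₀^S ∫ f dÑ` (unique up to `P`-null sets; the value `0` is used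
when the limit does not exist). -/
def forwardIntN {Ω : Type*} [MeasurableSpace Ω] (P : Measure Ω)
    (N : Ω → Measure (ℝ≥0 × ℝ)) (ν : Measure ℝ) (K : ℕ → Set ℝ)
    (f : ℝ≥0 → ℝ → Ω → ℝ) (S : Ω → ℝ≥0) : Ω → ℝ :=
  if h : ∃ J, HasForwardIntegralN P N ν K f S J then h.choose else 0

/-! ### The market -/

/-- The data of the market. `K` is the exhausting sequence of compact sets used in the
definition of the forward integral with respect to the compensated Poisson random measure. -/
structure Market (Ω : Type*) [mΩ : MeasurableSpace Ω] where
  T : ℝ≥0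
  x₀ : ℝ
  s₀ : ℝ
  G : Filtration ℝ≥0 mΩ
  W : ℝ≥0 → Ω → ℝ
  ν : Measure ℝ
  N : Ω → Measure (ℝ≥0 × ℝ)
  K : ℕ → Set ℝ
  H : ℝ≥0 → Ω → ℝ
  Λ : Ω → Measure ℝ≥0
  ρ : ℝ≥0 → Ω → ℝ
  μ : ℝ≥0 → Ω → ℝ
  σ : ℝ≥0 → Ω → ℝ
  κ : ℝ≥0 → Ω → ℝ
  θ : ℝ≥0 → ℝ → Ω → ℝ
  τ : Ω → ℝ≥0

namespace Market

variable {Ω : Type*} [mΩ : MeasurableSpace Ω] (M : Market Ω) (P : Measure Ω)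

/-- A random field is càglàd: for almost every `ω`, and for `ν`-almost every `z`, its path is
càglàd on `[0,T]`. -/
def IsCagladField (f : ℝ≥0 → ℝ → Ω → ℝ) : Prop :=
  ∀ᵐ ω ∂P, ∀ᵐ z ∂M.ν, IsCaglad M.T fun t => f t z ω

/-- The random field `f` is càglàd and forward integrable with respect to the compensated
Poisson random measure over `[0,T]`. -/
def ForwardIntegrableN (f : ℝ≥0 → ℝ → Ω → ℝ) : Prop :=
  M.IsCagladField P f ∧
  ∀ t ≤ M.T, ∃ J, HasForwardIntegralN P M.N M.ν M.K f (fun _ => t) J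

/-- As `ForwardIntegrableN`, and the integral up to the random time `τ` also exists. -/
def ForwardIntegrableNτ (f : ℝ≥0 → ℝ → Ω → ℝ) : Prop :=
  M.ForwardIntegrableN P f ∧ ∃ J, HasForwardIntegralN P M.N M.ν M.K f M.τ J

/-- The price of the risky asset `S₁`. -/
def S₁ (t : ℝ≥0) (ω : Ω) : ℝ :=
  M.s₀ * (∏ᶠ r ∈ Ioc 0 t, (1 + M.κ r ω * jump (M.H · ω) r)) *
  Real.exp (
    (∫ s in Ioc 0 t, (M.μ s ω - M.σ s ω ^ 2 / 2) ∂leb)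
    + forwardIntW P M.W M.T M.σ t ω
    + (∫ p in Ioc 0 t ×ˢ ({0}ᶜ : Set ℝ), (Real.log (1 + M.θ p.1 p.2 ω) - M.θ p.1 p.2 ω)
        ∂(leb.prod M.ν))
    + forwardIntN P M.N M.ν M.K (fun s z ω => Real.log (1 + M.θ s z ω)) (fun _ => t) ω)

/-- The standing assumptions on the market. -/
structure IsModel : Prop where
  complete : P.IsComplete
  T_pos : 0 < M.T
  x₀_pos : 0 < M.x₀
  s₀_pos : 0 < M.s₀
  -- the information flow of the investor
  right_continuous : M.G.IsRightContinuous
  augmented : ∀ B : Set Ω, P B = 0 → MeasurableSet[M.G 0] B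
  -- the noises
  brownian : IsBrownianReal M.W P
  ν_sigmaFinite : SigmaFinite M.ν
  ν_zero : M.ν {0} = 0
  ν_sq : ∫⁻ z, ENNReal.ofReal (z ^ 2) ∂M.ν < ∞
  poisson : IsPoissonRandomMeasure M.N (leb.prod M.ν) P
  indep : IndepFun (fun ω t => M.W t ω) M.N P
  counting : IsCountingProcess M.H M.T P
  intensity : IsPredictableIntensity M.G M.H M.Λ M.T P
  no_common_jumps : ∀ᵐ ω ∂P, ∀ t, 0 < t → t ≤ M.T → 0 < jump (M.H · ω) t →
    ∀ V : Set ℝ, IsCompact V → V ⊆ {0}ᶜ → M.N ω ({t} ×ˢ V) = 0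
  -- the exhausting sequence
  K_compact : ∀ m, IsCompact (M.K m)
  K_mono : Monotone M.K
  K_finite : ∀ m, M.ν (M.K m) < ∞
  K_iUnion : ⋃ m, M.K m = {0}ᶜ
  -- the coefficients
  ρ_meas : Measurable (Function.uncurry M.ρ)
  μ_meas : Measurable (Function.uncurry M.μ)
  σ_meas : Measurable (Function.uncurry M.σ)
  κ_meas : Measurable (Function.uncurry M.κ)
  θ_meas : Measurable fun p : ℝ≥0 × ℝ × Ω => M.θ p.1 p.2.1 p.2.2
  ρ_caglad : ∀ᵐ ω ∂P, IsCaglad M.T (M.ρ · ω)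
  μ_caglad : ∀ᵐ ω ∂P, IsCaglad M.T (M.μ · ω)
  σ_caglad : ∀ᵐ ω ∂P, IsCaglad M.T (M.σ · ω)
  κ_caglad : ∀ᵐ ω ∂P, IsCaglad M.T (M.κ · ω)
  θ_caglad : M.IsCagladField P M.θ
  σ_forward : ForwardIntegrableW P M.W M.T M.σ
  θ_forward : M.ForwardIntegrableN P M.θ
  log_θ_forward : M.ForwardIntegrableN P fun s z ω => Real.log (1 + M.θ s z ω)
  integrability : ∫⁻ ω,
      ((∫⁻ s in Ioc 0 M.T, ENNReal.ofReal (|M.μ s ω| + M.σ s ω ^ 2) ∂leb)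
        + (∫⁻ p in Ioc 0 M.T ×ˢ ({0}ᶜ : Set ℝ), ENNReal.ofReal (M.θ p.1 p.2 ω ^ 2)
            ∂(leb.prod M.ν))
        + ∫⁻ s in Ioc 0 M.T, ENNReal.ofReal |M.κ s ω| ∂(M.Λ ω)) ∂P < ∞
  θ_gt : ∀ᵐ ω ∂P, ∀ᵐ p ∂((leb.restrict (Ioc 0 M.T)).prod M.ν),
    -1 < M.θ p.1 p.2 ω
  κ_ge : ∀ᵐ ω ∂P, ∀ᵐ t ∂(leb.restrict (Ioc 0 M.T)), -1 ≤ M.κ t ω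
  -- the terminal time of the investment in `S₁`
  τ_stopping : IsStoppingTime M.G fun ω => (M.τ ω : WithTop ℝ≥0)
  τ_le : ∀ ω, M.τ ω ≤ M.T
  τ_le_zero_price : ∀ᵐ ω ∂P, ∀ t ≤ M.T, M.S₁ P t ω = 0 → M.τ ω ≤ t

/-! ### Portfolios -/

/-- The portfolio is a bounded process on `[0,T]`. -/
def IsBddPortfolio (π : ℝ≥0 → Ω → ℝ) : Prop :=
  ∃ C : ℝ, ∀ᵐ ω ∂P, ∀ t ≤ M.T, |π t ω| ≤ C

/-- Membership in the set of admissible portfolios. -/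
structure IsAdmissible (π : ℝ≥0 → Ω → ℝ) : Prop where
  caglad : ∀ᵐ ω ∂P, IsCaglad M.T (π · ω)
  adapted : ∀ t ≤ M.T, Measurable[M.G t] (π t)
  lower_bounds : ∃ ε : ℝ, 0 < ε ∧ ∀ᵐ ω ∂P, ∀ t ≤ M.T,
    -1 + ε < π t ω * M.κ t ω ∧ ∀ z : ℝ, z ≠ 0 → -1 + ε < π t ω * M.θ t z ω
  integrable_drift : ∫⁻ ω, ∫⁻ s in Ioc 0 M.T,
    ENNReal.ofReal (|M.μ s ω - M.ρ s ω| * |π s ω| + M.σ s ω ^ 2 * π s ω ^ 2) ∂leb ∂P < ∞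
  integrable_jump : ∫⁻ ω, ∫⁻ p in Ioc 0 M.T ×ˢ ({0}ᶜ : Set ℝ),
    ENNReal.ofReal (|M.θ p.1 p.2 ω * π p.1 ω| ^ 2)
      ∂(leb.prod M.ν) ∂P < ∞
  caglad_σ : ∀ᵐ ω ∂P, IsCaglad M.T fun t => π t ω * M.σ t ω
  forward_σ : ForwardIntegrableW P M.W M.T fun t ω => π t ω * M.σ t ω
  forward_θ : M.ForwardIntegrableNτ P fun t z ω => π t ω * M.θ t z ω
  forward_log : M.ForwardIntegrableNτ P fun t z ω => Real.log (1 + π t ω * M.θ t z ω)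
  forward_div : M.ForwardIntegrableNτ P fun t z ω =>
    π t ω * M.θ t z ω / (1 + π t ω * M.θ t z ω)

/-- The set of admissible portfolios. -/
def admissible : Set (ℝ≥0 → Ω → ℝ) := {π | M.IsAdmissible P π}

/-- The investor's terminal wealth `X_π(T)`: the wealth at time `τ`, given by the solution
formula of the forward wealth equation, invested in the bond on `(τ,T]`. -/
def terminalWealth (π : ℝ≥0 → Ω → ℝ) (ω : Ω) : ℝ :=
  M.x₀ * Real.exp (
    (∫ s in Ioc 0 (M.τ ω),
      (M.ρ s ω + (M.μ s ω - M.ρ s ω) * π s ω - M.σ s ω ^ 2 * π s ω ^ 2 / 2) ∂leb)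
    + (∫ p in Ioc 0 (M.τ ω) ×ˢ ({0}ᶜ : Set ℝ),
        (Real.log (1 + π p.1 ω * M.θ p.1 p.2 ω) - π p.1 ω * M.θ p.1 p.2 ω)
        ∂(leb.prod M.ν))
    + forwardIntW P M.W M.T (fun t ω => π t ω * M.σ t ω) (M.τ ω) ω
    + forwardIntN P M.N M.ν M.K (fun t z ω => Real.log (1 + π t ω * M.θ t z ω)) M.τ ω
    + jumpInt (M.H · ω) (fun s => Real.log (1 + M.κ s ω * π s ω)) 0 (M.τ ω))
  * Real.exp (∫ s in Ioc (M.τ ω) M.T, M.ρ s ω ∂leb)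

/-- The expected utility `E[U(X_π(T))]`, as the difference of the expectations of the positive and
the negative parts (equal to `-∞` if both are infinite). -/
def expectedUtility (U : ℝ → ℝ) (π : ℝ≥0 → Ω → ℝ) : EReal :=
  ((∫⁻ ω, ENNReal.ofReal (U (M.terminalWealth P π ω)) ∂P : ℝ≥0∞) : EReal)
    - ((∫⁻ ω, ENNReal.ofReal (-U (M.terminalWealth P π ω)) ∂P : ℝ≥0∞) : EReal)

/-- `π` is a local maximum: it cannot be improved by small admissible perturbations in the
direction of a bounded admissible `β`. -/
def IsLocalMaximum (U : ℝ → ℝ) (π : ℝ≥0 → Ω → ℝ) : Prop :=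
  π ∈ M.admissible P ∧
  ∀ β ∈ M.admissible P, M.IsBddPortfolio P β → ∃ δ : ℝ, 0 < δ ∧
    ∀ y : ℝ, |y| < δ → π + y • β ∈ M.admissible P →
      M.expectedUtility P U (π + y • β) ≤ M.expectedUtility P U π

/-! ### The assumptions -/

/-- The integrand `β θ / (1 + (π + y β) θ)`. -/
def ratioField (y : ℝ) (β π : ℝ≥0 → Ω → ℝ) (t : ℝ≥0) (z : ℝ) (ω : Ω) : ℝ :=
  β t ω * M.θ t z ω / (1 + (π t ω + y * β t ω) * M.θ t z ω)

/-- The random variable `Ψ(y,β,π)`. -/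
def Psi (y : ℝ) (β π : ℝ≥0 → Ω → ℝ) (ω : Ω) : ℝ :=
  (∫ s in Ioc 0 (M.τ ω),
      β s ω * (M.μ s ω - M.ρ s ω - (π s ω + y * β s ω) * M.σ s ω ^ 2) ∂leb)
    + (∫ p in Ioc 0 (M.τ ω) ×ˢ ({0}ᶜ : Set ℝ),
        (M.ratioField y β π p.1 p.2 ω - β p.1 ω * M.θ p.1 p.2 ω)
        ∂(leb.prod M.ν))
    + forwardIntW P M.W M.T (fun t ω => β t ω * M.σ t ω) (M.τ ω) ω
    + forwardIntN P M.N M.ν M.K (M.ratioField y β π) M.τ ω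
    + jumpInt (M.H · ω)
        (fun s => β s ω * M.κ s ω / (1 + M.κ s ω * (π s ω + y * β s ω))) 0 (M.τ ω)

/-- The random variable `Ψ_y(y,β,π)`. -/
def Psi_y (y : ℝ) (β π : ℝ≥0 → Ω → ℝ) (ω : Ω) : ℝ :=
  -(∫ s in Ioc 0 (M.τ ω), β s ω ^ 2 * M.σ s ω ^ 2 ∂leb)
    - (∫ p in Ioc 0 (M.τ ω) ×ˢ ({0}ᶜ : Set ℝ), M.ratioField y β π p.1 p.2 ω ^ 2 ∂(M.N ω))
    - jumpInt (M.H · ω)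
        (fun s => β s ω ^ 2 * M.κ s ω ^ 2 / (1 + (π s ω + y * β s ω) * M.κ s ω) ^ 2)
        0 (M.τ ω)

/-- For `|y| < δ` the wealth `X_{π+yβ}(T)` and the random variable `Ψ(y,β,π)` are well defined. -/
def WellDefinedNear (π β : ℝ≥0 → Ω → ℝ) (δ : ℝ) : Prop :=
  ∀ y : ℝ, |y| < δ →
    π + y • β ∈ M.admissible P ∧ M.ForwardIntegrableNτ P (M.ratioField y β π)

/-- The assumption `A_{u.i.}` for the utility function `U` and the portfolio `π`. -/
structure AssumptionUI (U : ℝ → ℝ) (π : ℝ≥0 → Ω → ℝ) : Prop where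
  integrable : Integrable (fun ω => U (M.terminalWealth P π ω)) P
  integrable_deriv :
    Integrable (fun ω => deriv U (M.terminalWealth P π ω) * M.terminalWealth P π ω) P
  pos_deriv : 0 < ∫ ω, deriv U (M.terminalWealth P π ω) * M.terminalWealth P π ω ∂P
  unif : ∀ β ∈ M.admissible P, M.IsBddPortfolio P β → ∃ δ : ℝ, 0 < δ ∧
    M.WellDefinedNear P π β δ ∧
    UniformIntegrable
      (fun (y : Ioo (-δ) δ) ω =>
        deriv U (M.terminalWealth P (π + (y : ℝ) • β) ω)
          * M.terminalWealth P (π + (y : ℝ) • β) ω * |M.Psi P y β π ω|) 1 P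

/-- The assumption `A_{d²}` for the utility function `U` and the portfolio `π`. -/
structure AssumptionD2 (U : ℝ → ℝ) (π : ℝ≥0 → Ω → ℝ) : Prop where
  differentiable : ∀ x, 0 < x → DifferentiableAt ℝ U x
  differentiable_deriv : ∀ x, 0 < x → DifferentiableAt ℝ (deriv U) x
  strictMono : StrictMonoOn U (Ioi 0)
  concave : ConcaveOn ℝ (Ioi 0) U
  unif : ∀ β ∈ M.admissible P, M.IsBddPortfolio P β → ∃ δ : ℝ, 0 < δ ∧
    M.WellDefinedNear P π β δ ∧
    UniformIntegrable
      (fun (y : Ioo (-δ) δ) ω =>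
        deriv (deriv U) (M.terminalWealth P (π + (y : ℝ) • β) ω)
            * M.terminalWealth P (π + (y : ℝ) • β) ω ^ 2 * M.Psi P y β π ω ^ 2
          + deriv U (M.terminalWealth P (π + (y : ℝ) • β) ω)
            * M.terminalWealth P (π + (y : ℝ) • β) ω
            * (M.Psi P y β π ω ^ 2 + M.Psi_y y β π ω)) 1 P

/-- The quadratic noise accumulated on `(s,t]`:
`∫ σ² dr + ∫∫ θ² N(dr,dz) + ∫ κ² dH`. -/
def noise (s t : ℝ≥0) (ω : Ω) : ℝ≥0∞ :=
  (∫⁻ r in Ioc s t, ENNReal.ofReal (M.σ r ω ^ 2) ∂leb)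
    + (∫⁻ p in Ioc s t ×ˢ ({0}ᶜ : Set ℝ), ENNReal.ofReal (M.θ p.1 p.2 ω ^ 2) ∂(M.N ω))
    + ENNReal.ofReal (jumpInt (M.H · ω) (fun r => M.κ r ω ^ 2) s t)

/-- The coefficients `σ`, `θ`, `κ` do not vanish simultaneously on a time interval: a stochastic
interval `(S,S']` before `τ` on which there is almost surely no noise is empty. -/
def Nondegenerate : Prop :=
  ∀ S S' : Ω → ℝ≥0,
    IsStoppingTime M.G (fun ω => (S ω : WithTop ℝ≥0)) →
    IsStoppingTime M.G (fun ω => (S' ω : WithTop ℝ≥0)) →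
    (∀ ω, S ω ≤ S' ω ∧ S' ω ≤ M.τ ω) →
    (∀ᵐ ω ∂P, M.noise (S ω) (S' ω) ω = 0) → ∀ᵐ ω ∂P, S ω = S' ω

end Market

end ForwardMarket

end

/-!
The logarithm `L(p)` of the terminal wealth is, path by path, a concave functional of the portfolio
`p`, and the condition `x U''(x) + U'(x) ≤ 0` says that `V = U ∘ exp` is concave. The expected
utility `E[V(L(p))]` is therefore concave in `p`, every local maximum satisfies a first order
condition, and two of them can only differ where `L` fails to be strictly concave. By
non-degeneracy this happens nowhere before `τ`.

*Concavity of `L`.* If `q = p + aβ + bγ`, then almost surely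
`L(q) = L(p) + a Ψ(0,β,p) + b Ψ(0,γ,p) - gap(p,q)` (`logWealth_eq_sub_wealthGap`), where
`gap(p,q) = ½ ∫ σ² (q - p)² ds + ∫∫ logGap(pθ, qθ) dN + ∫ logGap(κp, κq) dH` and
`logGap(u,v) ≥ 0` is the distance at `v` between `x ↦ ln (1 + x)` and its tangent at `u`. No
stochastic calculus is needed here. The Brownian forward integrals are limits of pathwise linear
expressions, hence linear, also at the random time `τ` (`forwardIntW_linear`). The four compensated
jump integrals converge almost surely along a common subsequence of the exhausting sets; along it
the compensators cancel, and the uncompensated integrals of the non-negative function `logGap`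
converge by monotonicity (`jump_gap`).

*First order condition.* At a local maximum `p`, `E[U'(X) X Ψ(0,β,p)] = 0` with `X = X_p(T)`, for
every bounded admissible `β` (`integral_marginal_eq_zero`). Concavity squeezes the difference
quotients of `y ↦ V(L(p + yβ))` between the marginal utilities at `p` and at `p + cβ`, which are
integrable by `A_{u.i.}`, and the quotients converge because the gap is of smaller order than the
step (`tendsto_wealthGap_div`). Thus dominated convergence applies.

*Comparison.* Let `p` and `q` be two local maxima. Linearizing `V ∘ L` at `p` gives
`U(X_q) ≤ U(X_p) + Z`, where `Z` is the marginal utility in the direction `q` minus the one in the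
direction `p`, so `E[Z] = 0`. Exchanging the roles shows that the expected utilities are equal; then
there is equality almost surely, and strict monotonicity of `U` forces `gap(p,q) = 0`
(`integral_utility_le_of_marginal_eq_zero`). Hence `p = q` wherever `σ`, `θ` or `κ` produces noise
(`eq_of_wealthGap_eq_zero`).

*Non-degeneracy.* If the càglàd process `p - q` were non-zero somewhere in `(0,τ]`, then `|p - q|`
would exceed some `1/(n+1)` on an interval starting at a point `a` of a countable dense set. The
interval from `a` to the first time in the dense set at which `|p - q| ≤ 1/(n+1)` (or to `τ`, if that
comes first) is a stochastic interval on which `p - q` does not vanish. Thus it carries no noise,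
so it is empty (`eq_zero_of_nondegenerate`).
-/

noncomputable section

namespace ForwardMarket

/-! ### Lebesgue measure on the time axis and càglàd paths -/

theorem leb_Ioc (s t : ℝ≥0) : leb (Ioc s t) = ENNReal.ofReal (t - s) := by
  have he : MeasurableEmbedding ((↑) : ℝ≥0 → ℝ) :=
    MeasurableEmbedding.subtype_coe (measurableSet_Ici (a := (0 : ℝ)))
  have hs : ((↑) : ℝ≥0 → ℝ) '' Ioc s t = Ioc (s : ℝ) t := by
    ext x
    constructor
    · rintro ⟨y, hy, rfl⟩
      exact ⟨by exact_mod_cast hy.1, by exact_mod_cast hy.2⟩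
    · intro hx
      refine ⟨⟨x, s.2.trans hx.1.le⟩, ⟨?_, ?_⟩, rfl⟩
      · exact_mod_cast hx.1
      · exact_mod_cast hx.2
  rw [leb, he.comap_apply, hs, Real.volume_Ioc]

theorem leb_singleton_zero : leb {0} = 0 := by
  have he : MeasurableEmbedding ((↑) : ℝ≥0 → ℝ) :=
    MeasurableEmbedding.subtype_coe (measurableSet_Ici (a := (0 : ℝ)))
  rw [leb, he.comap_apply]
  simp

instance : SigmaFinite leb := by
  refine ⟨⟨⟨fun n => insert 0 (Ioc 0 (n : ℝ≥0)), fun _ => trivial, fun n => ?_, ?_⟩⟩⟩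
  · rw [insert_eq]
    refine (measure_union_le _ _).trans_lt ?_
    rw [leb_singleton_zero, leb_Ioc, zero_add]
    exact ENNReal.ofReal_lt_top
  · refine eq_univ_of_forall fun t => mem_iUnion.2 ?_
    obtain ⟨n, hn⟩ := exists_nat_ge t
    refine ⟨n, ?_⟩
    rcases eq_or_ne t 0 with rfl | h
    · exact mem_insert _ _
    · exact mem_insert_of_mem _ ⟨pos_iff_ne_zero.2 h, hn⟩

/-- The largest point of the grid `ℕ / (n + 1)` strictly to the left of `t` (for `t > 0`). -/
def leftGrid (n : ℕ) (t : ℝ≥0) : ℝ≥0 := ((⌈(n + 1 : ℝ≥0) * t⌉₊ - 1 : ℕ) : ℝ≥0) / (n + 1)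

theorem leftGrid_lt (n : ℕ) {t : ℝ≥0} (ht : 0 < t) : leftGrid n t < t := by
  have hn : (0 : ℝ≥0) < n + 1 := by positivity
  rw [leftGrid, div_lt_iff₀' hn]
  have h1 : 0 < ⌈(n + 1 : ℝ≥0) * t⌉₊ := Nat.ceil_pos.2 (by positivity)
  exact Nat.lt_ceil.1 (Nat.sub_lt h1 one_pos)

theorem le_leftGrid_add (n : ℕ) (t : ℝ≥0) : t ≤ leftGrid n t + 1 / (n + 1) := by
  have hn : (0 : ℝ≥0) < n + 1 := by positivity
  rw [leftGrid, ← add_div, le_div_iff₀' hn]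
  refine (Nat.le_ceil _).trans ?_
  exact_mod_cast (le_tsub_add : ⌈(n + 1 : ℝ≥0) * t⌉₊ ≤ (⌈(n + 1 : ℝ≥0) * t⌉₊ - 1) + 1)

theorem tendsto_leftGrid {t : ℝ≥0} (ht : 0 < t) :
    Tendsto (fun n => leftGrid n t) atTop (𝓝[<] t) := by
  refine tendsto_nhdsWithin_iff.2 ⟨?_, Eventually.of_forall fun n => leftGrid_lt n ht⟩
  have h0 : Tendsto (fun n : ℕ => t - 1 / ((n : ℝ≥0) + 1)) atTop (𝓝 t) := by
    have := (tendsto_one_div_add_atTop_nhds_zero_nat (𝕜 := ℝ≥0))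
    simpa using (tendsto_const_nhds (x := t)).sub this
  refine tendsto_of_tendsto_of_tendsto_of_le_of_le h0 tendsto_const_nhds (fun n => ?_)
    (fun n => (leftGrid_lt n ht).le)
  exact tsub_le_iff_right.2 (le_leftGrid_add n t)

/-- A process with almost surely left continuous paths on `(0,T]` agrees there, up to a null
set, with a jointly measurable map. -/
theorem exists_measurable_version {Ω : Type*} [MeasurableSpace Ω] {P : Measure Ω} {T : ℝ≥0}
    {X : ℝ≥0 → Ω → ℝ} (hX : ∀ t ≤ T, AEMeasurable (X t) P)
    (hc : ∀ᵐ ω ∂P, ∀ t, 0 < t → t ≤ T → ContinuousWithinAt (X · ω) (Iio t) t) :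
    ∃ Y : ℝ≥0 × Ω → ℝ, Measurable Y ∧ ∀ᵐ ω ∂P, ∀ t ∈ Ioc 0 T, Y (t, ω) = X t ω := by
  classical
  let Z : ℝ≥0 → Ω → ℝ := fun t => if h : t ≤ T then (hX t h).mk (X t) else 0
  have hZ : ∀ t, Measurable (Z t) := by
    intro t
    by_cases h : t ≤ T
    · simp only [Z, h, dif_pos]; exact (hX t h).measurable_mk
    · simp only [Z, h, dif_neg, not_false_iff]; exact measurable_const
  let Yn : ℕ → ℝ≥0 × Ω → ℝ := fun n p => Z (leftGrid n p.1) p.2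
  have hYn : ∀ n, Measurable (Yn n) := by
    intro n
    have h1 : Measurable fun q : ℕ × Ω => Z (((q.1 - 1 : ℕ) : ℝ≥0) / (n + 1)) q.2 :=
      measurable_from_prod_countable_right fun k =>
        hZ (((k - 1 : ℕ) : ℝ≥0) / (n + 1))
    have h2 : Measurable fun p : ℝ≥0 × Ω => (⌈(n + 1 : ℝ≥0) * p.1⌉₊, p.2) :=
      (Nat.measurable_ceil.comp (measurable_const.mul measurable_fst)).prodMk measurable_snd
    have h3 : Yn n = (fun q : ℕ × Ω => Z (((q.1 - 1 : ℕ) : ℝ≥0) / (n + 1)) q.2) ∘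
        fun p : ℝ≥0 × Ω => (⌈(n + 1 : ℝ≥0) * p.1⌉₊, p.2) := by
      funext p
      simp only [Yn, leftGrid, Function.comp_apply]
    rw [h3]
    exact h1.comp h2
  refine ⟨fun p => limsup (fun n => Yn n p) atTop, Measurable.limsup hYn, ?_⟩
  have hae : ∀ᵐ ω ∂P, ∀ n k : ℕ, (k : ℝ≥0) / (n + 1) ≤ T →
      Z ((k : ℝ≥0) / (n + 1)) ω = X ((k : ℝ≥0) / (n + 1)) ω := by
    refine ae_all_iff.2 fun n => ae_all_iff.2 fun k => ?_
    by_cases h : (k : ℝ≥0) / (n + 1) ≤ T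
    · filter_upwards [(hX _ h).ae_eq_mk] with ω hω _
      simp only [Z, h, dif_pos]; exact hω.symm
    · exact Eventually.of_forall fun ω h' => absurd h' h
  filter_upwards [hc, hae] with ω h1 h2 t ht
  refine Tendsto.limsup_eq ?_
  refine ((h1 t ht.1 ht.2).tendsto.comp (tendsto_leftGrid ht.1)).congr fun n => ?_
  exact (h2 n _ ((leftGrid_lt n ht.1).le.trans ht.2)).symm

theorem IsCaglad.measurable_indicator {T : ℝ≥0} {f : ℝ≥0 → ℝ} (hf : IsCaglad T f) :
    Measurable ((Ioc 0 T).indicator f) := by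
  obtain ⟨Y, hY, h⟩ := exists_measurable_version (P := Measure.dirac ()) (T := T)
    (X := fun t (_ : Unit) => f t) (fun t _ => aemeasurable_const)
    (Eventually.of_forall fun _ => hf.1)
  have h' : ∀ t ∈ Ioc 0 T, Y (t, ()) = f t := by simpa using h
  have : (Ioc 0 T).indicator f = (Ioc 0 T).indicator fun t => Y (t, ()) :=
    indicator_congr fun t ht => (h' t ht).symm
  rw [this]
  exact (hY.comp (measurable_id.prodMk measurable_const)).indicator measurableSet_Ioc

theorem IsCaglad.add {T : ℝ≥0} {f g : ℝ≥0 → ℝ} (hf : IsCaglad T f) (hg : IsCaglad T g) :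
    IsCaglad T fun t => f t + g t := by
  refine ⟨fun t h0 h1 => (hf.1 t h0 h1).add (hg.1 t h0 h1), fun t ht => ?_⟩
  obtain ⟨l, hl⟩ := hf.2 t ht
  obtain ⟨l', hl'⟩ := hg.2 t ht
  exact ⟨_, hl.add hl'⟩

theorem IsCaglad.mul {T : ℝ≥0} {f g : ℝ≥0 → ℝ} (hf : IsCaglad T f) (hg : IsCaglad T g) :
    IsCaglad T fun t => f t * g t := by
  refine ⟨fun t h0 h1 => (hf.1 t h0 h1).mul (hg.1 t h0 h1), fun t ht => ?_⟩
  obtain ⟨l, hl⟩ := hf.2 t ht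
  obtain ⟨l', hl'⟩ := hg.2 t ht
  exact ⟨_, hl.mul hl'⟩

theorem isCaglad_of_continuous (T : ℝ≥0) {f : ℝ≥0 → ℝ} (hf : Continuous f) : IsCaglad T f :=
  ⟨fun _ _ _ => hf.continuousWithinAt, fun t _ => ⟨f t, hf.continuousAt.mono_left inf_le_left⟩⟩

theorem IsCaglad.const_mul {T : ℝ≥0} {f : ℝ≥0 → ℝ} (c : ℝ) (hf : IsCaglad T f) :
    IsCaglad T fun t => c * f t := (isCaglad_of_continuous T continuous_const).mul hf

theorem IsCaglad.sub {T : ℝ≥0} {f g : ℝ≥0 → ℝ} (hf : IsCaglad T f) (hg : IsCaglad T g) :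
    IsCaglad T fun t => f t - g t := by
  simpa [sub_eq_add_neg] using hf.add (hg.const_mul (-1))

/-- A càglàd path is bounded on `[0,T]`: it is bounded near every point, from both sides. -/
theorem IsCaglad.exists_bound {T : ℝ≥0} {f : ℝ≥0 → ℝ} (hf : IsCaglad T f) :
    ∃ C : ℝ, ∀ t ≤ T, |f t| ≤ C := by
  have hloc : ∀ t ∈ Icc 0 T, ∃ u ∈ 𝓝[Icc 0 T] t, ∃ C : ℝ, ∀ s ∈ u, |f s| ≤ C := by
    intro t ht
    have hl : ∃ C : ℝ, ∀ᶠ s in 𝓝[<] t, |f s| ≤ C := by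
      rcases eq_or_ne t 0 with rfl | h0
      · exact ⟨0, by simp⟩
      · have := ((hf.1 t (pos_iff_ne_zero.2 h0) ht.2).tendsto.abs).eventually
          (gt_mem_nhds (lt_add_one |f t|))
        exact ⟨|f t| + 1, this.mono fun s hs => hs.le⟩
    have hr : ∃ C : ℝ, ∀ᶠ s in 𝓝[>] t, s ≤ T → |f s| ≤ C := by
      rcases ht.2.eq_or_lt with rfl | h0
      · exact ⟨0, eventually_nhdsWithin_of_forall fun s hs hs' => absurd hs' (not_le.2 hs)⟩
      · obtain ⟨l, hl⟩ := hf.2 t h0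
        exact ⟨|l| + 1, (hl.abs.eventually (gt_mem_nhds (lt_add_one |l|))).mono
          fun s hs _ => hs.le⟩
    obtain ⟨C₁, h₁⟩ := hl
    obtain ⟨C₂, h₂⟩ := hr
    rw [eventually_nhdsWithin_iff] at h₁ h₂
    refine ⟨{s | |f s| ≤ max (max C₁ C₂) |f t|}, ?_, _, fun s hs => hs⟩
    rw [mem_nhdsWithin_iff_eventually]
    filter_upwards [h₁, h₂] with s h1 h2 hs
    rcases lt_trichotomy s t with h | h | h
    · exact (h1 h).trans ((le_max_left _ _).trans (le_max_left _ _))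
    · simp [h]
    · exact (h2 h hs.2).trans ((le_max_right _ _).trans (le_max_left _ _))
  obtain ⟨C, hC⟩ : ∃ C : ℝ, ∀ s ∈ Icc 0 T, |f s| ≤ C := by
    refine isCompact_Icc.induction_on (p := fun S => ∃ C : ℝ, ∀ s ∈ S, |f s| ≤ C) ⟨0, by simp⟩
      ?_ ?_ hloc
    · rintro _ _ hst ⟨C, hC⟩
      exact ⟨C, fun x hx => hC x (hst hx)⟩
    · rintro s t ⟨C, hC⟩ ⟨D, hD⟩
      refine ⟨max C D, fun x hx => ?_⟩
      rcases hx with hx | hx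
      · exact (hC x hx).trans (le_max_left _ _)
      · exact (hD x hx).trans (le_max_right _ _)
  exact ⟨C, fun s hs => hC s ⟨zero_le, hs⟩⟩

theorem aemeasurable_of_measurable_indicator {α : Type*} [MeasurableSpace α] {m : Measure α}
    {s : Set α} (hs : MeasurableSet s) {f : α → ℝ} (hf : Measurable (s.indicator f)) :
    AEMeasurable f (m.restrict s) :=
  (aemeasurable_indicator_iff hs).1 hf.aemeasurable

theorem IsCaglad.integrableOn {T : ℝ≥0} {f : ℝ≥0 → ℝ} (hf : IsCaglad T f) :
    IntegrableOn f (Ioc 0 T) leb := by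
  obtain ⟨C, hC⟩ := hf.exists_bound
  refine IntegrableOn.of_bound (C := C) ?_ ?_ ?_
  · rw [leb_Ioc]; exact ENNReal.ofReal_lt_top
  · exact (aemeasurable_of_measurable_indicator measurableSet_Ioc
      hf.measurable_indicator).aestronglyMeasurable
  · exact (ae_restrict_mem measurableSet_Ioc).mono fun t ht => hC t ht.2

/-! ### Sums over the jumps of a counting process -/

/-- A path of a counting process with unit jumps on `[0,T]`. -/
structure IsCountingPath (T : ℝ≥0) (h : ℝ≥0 → ℝ) : Prop where
  zero : h 0 = 0
  nat_valued : ∀ t, ∃ n : ℕ, h t = n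
  mono : Monotone h
  right_cont : ∀ t, ContinuousWithinAt h (Ioi t) t
  jump_le : ∀ t ≤ T, jump h t ≤ 1

theorem IsCountingProcess.ae_isCountingPath {Ω : Type*} [MeasurableSpace Ω] {H : ℝ≥0 → Ω → ℝ}
    {T : ℝ≥0} {P : Measure Ω} (hH : IsCountingProcess H T P) :
    ∀ᵐ ω ∂P, IsCountingPath T (H · ω) := by
  filter_upwards [hH.zero, hH.nat_valued, hH.mono, hH.right_cont, hH.jump_le] with ω h1 h2 h3 h4 h5
  exact ⟨h1, h2, h3, h4, h5⟩

namespace IsCountingPath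

variable {T : ℝ≥0} {h : ℝ≥0 → ℝ}

theorem jump_nonneg (hh : IsCountingPath T h) (t : ℝ≥0) : 0 ≤ jump h t :=
  sub_nonneg.2 (hh.mono.leftLim_le le_rfl)

/-- If `h < k` strictly before `t` then `h(t-) ≤ k - 1`, as the values of `h` are integers. -/
theorem leftLim_le_of_forall_lt (hh : IsCountingPath T h) {t : ℝ≥0} (ht : 0 < t) {k : ℕ}
    (hk : ∀ s < t, h s < k) : Function.leftLim h t ≤ k - 1 := by
  have : (𝓝[<] t).NeBot := nhdsLT_neBot_of_exists_lt ⟨0, ht⟩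
  refine le_of_tendsto (hh.mono.tendsto_leftLim t) (eventually_nhdsWithin_of_forall fun s hs => ?_)
  obtain ⟨n, hn⟩ := hh.nat_valued s
  have := hk s hs
  rw [hn] at this ⊢
  have h2 : n + 1 ≤ k := by exact_mod_cast this
  have h3 : (n : ℝ) + 1 ≤ k := by exact_mod_cast h2
  linarith

theorem lt_of_jump_ne_zero (hh : IsCountingPath T h) {s t : ℝ≥0} (hj : jump h t ≠ 0)
    (hst : s < t) : h s < h t := by
  have h1 : 0 < jump h t := lt_of_le_of_ne (hh.jump_nonneg t) hj.symm
  exact (hh.mono.le_leftLim hst).trans_lt (sub_pos.1 h1)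

theorem finite_jumps (hh : IsCountingPath T h) (S : ℝ≥0) :
    {r | r ∈ Ioc 0 S ∧ jump h r ≠ 0}.Finite := by
  obtain ⟨n, hn⟩ := hh.nat_valued S
  -- `h` maps the jump times injectively into `{0, …, h(S)}`
  refine Set.Finite.of_finite_image (f := h)
    (((Finset.range (n + 1)).image (fun k : ℕ => (k : ℝ))).finite_toSet.subset ?_) ?_
  · rintro _ ⟨r, hr, rfl⟩
    obtain ⟨k, hk⟩ := hh.nat_valued r
    have := hh.mono hr.1.2
    rw [hk, hn] at this
    have : k ≤ n := by exact_mod_cast this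
    rw [hk]
    simp only [Finset.coe_image, Finset.coe_range, mem_image, mem_Iio]
    exact ⟨k, by omega, rfl⟩
  · intro r hr s hs hrs
    rcases lt_trichotomy r s with h1 | h1 | h1
    · exact absurd hrs (hh.lt_of_jump_ne_zero hs.2 h1).ne
    · exact h1
    · exact absurd hrs (hh.lt_of_jump_ne_zero hr.2 h1).ne'

/-- The jump times in `(0,S]`. -/
def jumps (hh : IsCountingPath T h) (S : ℝ≥0) : Finset ℝ≥0 := (hh.finite_jumps S).toFinset

theorem mem_jumps (hh : IsCountingPath T h) {S r : ℝ≥0} :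
    r ∈ hh.jumps S ↔ r ∈ Ioc 0 S ∧ jump h r ≠ 0 := by
  simp [jumps]

theorem jumpInt_eq_sum (hh : IsCountingPath T h) (g : ℝ≥0 → ℝ) (S : ℝ≥0) :
    jumpInt h g 0 S = ∑ r ∈ hh.jumps S, g r * jump h r := by
  refine finsum_mem_eq_sum_of_inter_support_eq _ ?_
  ext r
  simp only [mem_inter_iff, Function.mem_support, Finset.mem_coe, hh.mem_jumps]
  constructor
  · rintro ⟨h1, h2⟩; exact ⟨⟨h1, right_ne_zero_of_mul h2⟩, h2⟩
  · rintro ⟨h1, h2⟩; exact ⟨h1.1, h2⟩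

theorem jumpInt_nonneg (hh : IsCountingPath T h) {g : ℝ≥0 → ℝ} {S : ℝ≥0}
    (hg : ∀ r ∈ Ioc 0 S, 0 ≤ g r) : 0 ≤ jumpInt h g 0 S := by
  rw [hh.jumpInt_eq_sum]
  exact Finset.sum_nonneg fun r hr => mul_nonneg (hg r (hh.mem_jumps.1 hr).1) (hh.jump_nonneg r)

/-- Enumeration of the jumps: if `T_k` is the first time at which `h ≥ k`, then the sum of `g`
over the (unit) jumps in `(0,S]` is `g(T₁) + ⋯ + g(T_n)` with `n = h(S)`. -/
theorem jumpInt_eq_sum_jumpTime (hh : IsCountingPath T h) (g : ℝ≥0 → ℝ) {S : ℝ≥0} (hS : S ≤ T)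
    {n : ℕ} (hn : h S = n) {jt : ℕ → ℝ≥0}
    (hjt : ∀ k ∈ Finset.Icc 1 n, ∀ t, jt k ≤ t ↔ (k : ℝ) ≤ h t) :
    jumpInt h g 0 S = ∑ k ∈ Finset.Icc 1 n, g (jt k) := by
  have hle : ∀ k ∈ Finset.Icc 1 n, jt k ≤ S := fun k hk => by
    rw [hjt k hk, hn]; exact_mod_cast (Finset.mem_Icc.1 hk).2
  have hpos : ∀ k ∈ Finset.Icc 1 n, 0 < jt k := fun k hk => by
    refine lt_of_not_ge fun h0 => ?_
    rw [hjt k hk, hh.zero] at h0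
    have := (Finset.mem_Icc.1 hk).1
    exact absurd (by exact_mod_cast h0 : k ≤ 0) (by omega)
  have hll : ∀ k ∈ Finset.Icc 1 n, Function.leftLim h (jt k) ≤ k - 1 := fun k hk =>
    hh.leftLim_le_of_forall_lt (hpos k hk) fun s hs => by
      by_contra! hc
      exact absurd ((hjt k hk s).2 hc) (not_le.2 hs)
  have hge : ∀ k ∈ Finset.Icc 1 n, (k : ℝ) ≤ h (jt k) := fun k hk => (hjt k hk _).1 le_rfl
  have hjump : ∀ k ∈ Finset.Icc 1 n, jump h (jt k) = 1 := fun k hk => by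
    refine le_antisymm (hh.jump_le _ ((hle k hk).trans hS)) ?_
    have h1 := hll k hk
    have h2 := hge k hk
    rw [jump]; linarith
  have hval : ∀ k ∈ Finset.Icc 1 n, h (jt k) = k := fun k hk => by
    have h1 := hll k hk
    have h2 := hge k hk
    have h3 := hjump k hk
    rw [jump] at h3; linarith
  have hinj : Set.InjOn jt (Finset.Icc 1 n) := fun k hk l hl hkl => by
    have h1 := hval k hk
    rw [hkl, hval l hl] at h1
    exact_mod_cast h1.symm
  rw [hh.jumpInt_eq_sum]
  have himg : hh.jumps S = (Finset.Icc 1 n).image jt := by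
    ext r
    rw [hh.mem_jumps, Finset.mem_image]
    constructor
    · rintro ⟨hr, hj⟩
      obtain ⟨k, hk⟩ := hh.nat_valued r
      have h1 := hh.lt_of_jump_ne_zero hj hr.1
      have h2 := hh.mono hr.2
      rw [hh.zero, hk] at h1
      rw [hk, hn] at h2
      have hkn : k ∈ Finset.Icc 1 n :=
        Finset.mem_Icc.2 ⟨by exact_mod_cast h1, by exact_mod_cast h2⟩
      refine ⟨k, hkn, le_antisymm ((hjt k hkn r).2 hk.ge) (le_of_not_gt fun hlt => ?_)⟩
      have h3 := hh.lt_of_jump_ne_zero hj hlt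
      rw [hval k hkn, hk] at h3
      exact lt_irrefl _ h3
    · rintro ⟨k, hk, rfl⟩
      exact ⟨⟨hpos k hk, hle k hk⟩, by rw [hjump k hk]; exact one_ne_zero⟩
  rw [himg, Finset.sum_image hinj]
  exact Finset.sum_congr rfl fun k hk => by rw [hjump k hk, mul_one]

/-- The first time at which `h ≥ k` is an infimum over the rationals, by right continuity. As a
countable infimum it depends measurably on the path. -/
theorem iInf_le_iff (hh : IsCountingPath T h) (k : ℕ) (t : ℝ≥0) :
    (⨅ q : ℚ≥0, if (k : ℝ) ≤ h (q : ℝ≥0) then ((q : ℝ≥0) : ℝ≥0∞) else ∞) ≤ t ↔ (k : ℝ) ≤ h t := by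
  constructor
  · intro hle
    by_contra! hlt
    have h1 : ∀ᶠ u in 𝓝[>] t, h u < k := (hh.right_cont t).eventually (gt_mem_nhds hlt)
    obtain ⟨u, hu, htu⟩ := (h1.and self_mem_nhdsWithin).exists
    refine absurd hle (not_le.2 (lt_of_lt_of_le (ENNReal.coe_lt_coe.2 (mem_Ioi.1 htu))
      (le_iInf fun q => ?_)))
    split_ifs with hq
    · refine ENNReal.coe_le_coe.2 (le_of_not_gt fun hqu => ?_)
      exact absurd (hq.trans (hh.mono hqu.le)) (not_le.2 hu)
    · exact le_top
  · intro hk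
    refine ENNReal.le_of_forall_pos_le_add fun ε hε _ => ?_
    obtain ⟨q, hq1, hq2⟩ := exists_rat_btwn (show (t : ℝ) < t + ε by
      have : (0 : ℝ) < ε := hε
      linarith)
    have hq0 : 0 ≤ q := by
      have : (0 : ℝ) ≤ q := t.2.trans hq1.le
      exact_mod_cast this
    lift q to ℚ≥0 using hq0
    have hcast : ((q : ℝ≥0) : ℝ) = ((q : ℚ) : ℝ) := by
      rw [Rat.cast_nnratCast]; exact map_nnratCast NNReal.toRealHom q
    have hq1' : t < (q : ℝ≥0) := by
      rw [← NNReal.coe_lt_coe, hcast]; exact hq1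
    have hq2' : (q : ℝ≥0) ≤ t + ε := by
      rw [← NNReal.coe_le_coe, hcast]; exact hq2.le
    refine (iInf_le _ q).trans ?_
    rw [if_pos (hk.trans (hh.mono hq1'.le))]
    exact_mod_cast hq2'

end IsCountingPath

/-- The jump sum up to a random time is a random variable. -/
theorem aemeasurable_jumpInt {Ω : Type*} [MeasurableSpace Ω] {P : Measure Ω}
    {H : ℝ≥0 → Ω → ℝ} {T : ℝ≥0} (hH : IsCountingProcess H T P) {S : Ω → ℝ≥0}
    (hS : Measurable S) (hST : ∀ ω, S ω ≤ T) {g : ℝ≥0 → Ω → ℝ} {Y : ℝ≥0 × Ω → ℝ}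
    (hY : Measurable Y) (hg : ∀ᵐ ω ∂P, ∀ t ∈ Ioc 0 T, Y (t, ω) = g t ω) :
    AEMeasurable (fun ω => jumpInt (H · ω) (g · ω) 0 (S ω)) P := by
  classical
  let τ : ℕ → Ω → ℝ≥0∞ := fun k ω =>
    ⨅ q : ℚ≥0, if (k : ℝ) ≤ H (q : ℝ≥0) ω then ((q : ℝ≥0) : ℝ≥0∞) else ∞
  have hτ : ∀ k, Measurable (τ k) := fun k => Measurable.iInf fun q =>
    Measurable.ite (measurableSet_le measurable_const (hH.measurable _)) measurable_const
      measurable_const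
  let F : ℕ → Ω → ℝ := fun k ω =>
    if τ k ω ≤ (S ω : ℝ≥0∞) then Y ((τ k ω).toNNReal, ω) else 0
  have hF : ∀ k, Measurable (F k) := fun k =>
    Measurable.ite (measurableSet_le (hτ k) hS.coe_nnreal_ennreal)
      (hY.comp ((hτ k).ennreal_toNNReal.prodMk measurable_id)) measurable_const
  refine aemeasurable_of_tendsto_metrizable_ae (u := atTop)
    (f := fun n ω => ∑ k ∈ Finset.Icc 1 n, F k ω)
    (fun n => (Finset.measurable_sum _ fun k _ => hF k).aemeasurable) ?_
  filter_upwards [hg, hH.ae_isCountingPath] with ω hω hh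
  obtain ⟨n, hn⟩ := hh.nat_valued (S ω)
  have hle : ∀ k t, τ k ω ≤ (t : ℝ≥0) ↔ (k : ℝ) ≤ H t ω := fun k t => hh.iInf_le_iff k t
  have hfin : ∀ k ∈ Finset.Icc 1 n, τ k ω ≤ S ω := fun k hk => by
    rw [hle]
    have := (Finset.mem_Icc.1 hk).2
    rw [hn]; exact_mod_cast this
  have hjt : ∀ k ∈ Finset.Icc 1 n, ∀ t, (τ k ω).toNNReal ≤ t ↔ (k : ℝ) ≤ H t ω := by
    intro k hk t
    rw [← hle, ← ENNReal.coe_le_coe,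
      ENNReal.coe_toNNReal ((hfin k hk).trans_lt ENNReal.coe_lt_top).ne]
  have hlim : jumpInt (H · ω) (g · ω) 0 (S ω) = ∑ k ∈ Finset.Icc 1 n, F k ω := by
    rw [hh.jumpInt_eq_sum_jumpTime _ (hST ω) hn hjt]
    refine Finset.sum_congr rfl fun k hk => ?_
    have h1 : (τ k ω).toNNReal ≤ S ω := by
      rw [hjt k hk, ← hle]; exact hfin k hk
    have h0 : 0 < (τ k ω).toNNReal := by
      refine lt_of_not_ge fun h0 => ?_
      have h2 := (hjt k hk 0).1 h0
      have h3 := hh.zero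
      rw [h3] at h2
      have := (Finset.mem_Icc.1 hk).1
      exact absurd (by exact_mod_cast h2 : k ≤ 0) (by omega)
    simp only [F]
    rw [if_pos (hfin k hk), hω _ ⟨h0, h1.trans (hST ω)⟩]
  rw [hlim]
  refine tendsto_const_nhds.congr' ?_
  filter_upwards [eventually_ge_atTop n] with m hm
  refine Finset.sum_subset (Finset.Icc_subset_Icc_right hm) fun k hk hk' => ?_
  simp only [F]
  rw [if_neg]
  rw [hle]
  rw [hn]
  simp only [Finset.mem_Icc, not_and, not_le] at hk hk' ⊢
  exact_mod_cast hk' hk.1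

/-! ### Poisson random measures: finiteness and integrability -/

theorem IsPoissonRandomMeasure.ae_lt_top {Ω E : Type*} [MeasurableSpace Ω] [MeasurableSpace E]
    {N : Ω → Measure E} {m : Measure E} {P : Measure Ω} [IsProbabilityMeasure P]
    (hN : IsPoissonRandomMeasure N m P) {B : Set E} (hB : MeasurableSet B) (hmB : m B ≠ ∞) :
    ∀ᵐ ω ∂P, N ω B < ∞ := by
  have hmeas : Measurable fun ω => N ω B := (Measure.measurable_coe hB).comp hN.measurable
  -- the probabilities of the events `N B = n`, `n ∈ ℕ`, add up to one
  have hone : P (⋃ n : ℕ, {ω | N ω B = n}) = 1 := by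
    rw [measure_iUnion]
    · rw [tsum_congr (hN.law B hB hmB)]
      have h := measure_iUnion (μ := poissonMeasure (m B).toNNReal) (f := fun n : ℕ => {n})
        (fun i j hij => disjoint_singleton.2 hij) (fun _ => measurableSet_singleton _)
      rw [← h, iUnion_of_singleton, measure_univ]
    · intro i j hij
      refine Set.disjoint_left.2 fun ω h1 h2 => hij ?_
      have h3 : (i : ℝ≥0∞) = j := (show N ω B = i from h1).symm.trans h2
      exact_mod_cast h3
    · exact fun n => hmeas (measurableSet_singleton _)
  have hone' : ∀ᵐ ω ∂P, ω ∈ ⋃ n : ℕ, {ω | N ω B = n} := by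
    rw [ae_iff, ← compl_def, prob_compl_eq_zero_iff]
    · exact hone
    · exact MeasurableSet.iUnion fun n => hmeas (measurableSet_singleton _)
  filter_upwards [hone'] with ω hω
  obtain ⟨n, hn⟩ := mem_iUnion.1 hω
  rw [show N ω B = n from hn]
  exact ENNReal.natCast_lt_top n

/-- A measurable function is integrable over a set of finite mass of an integer valued measure:
the mass of `{|f| > n}` tends to zero along the integers, so `f` is essentially bounded. -/
theorem integrableOn_of_integer_valued {E : Type*} [MeasurableSpace E] {m : Measure E}
    (hm : ∀ B, MeasurableSet B → ∃ n : ℕ∞, m B = (n : ℝ≥0∞)) {B : Set E} (hB : MeasurableSet B)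
    (hfin : m B < ∞) {f : E → ℝ} (hf : AEMeasurable f (m.restrict B)) : IntegrableOn f B m := by
  have hg : Measurable (hf.mk f) := hf.measurable_mk
  refine IntegrableOn.congr_fun_ae ?_ hf.ae_eq_mk.symm
  set g := hf.mk f
  let A : ℕ → Set E := fun n => B ∩ {x | (n : ℝ) < |g x|}
  have hA : ∀ n, MeasurableSet (A n) := fun n =>
    hB.inter (measurableSet_lt measurable_const hg.abs)
  have hlim : Tendsto (fun n => m (A n)) atTop (𝓝 0) := by
    have hempty : ⋂ n, A n = ∅ := by
      refine eq_empty_of_forall_notMem fun x hx => ?_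
      obtain ⟨n, hn⟩ := exists_nat_ge |g x|
      exact absurd (mem_iInter.1 hx n).2 (not_lt.2 hn)
    rw [← measure_empty (μ := m), ← hempty]
    refine tendsto_measure_iInter_atTop (fun n => (hA n).nullMeasurableSet) ?_ ⟨0, ?_⟩
    · intro i j hij x hx
      exact ⟨hx.1, lt_of_le_of_lt (b := (j : ℝ)) (by exact_mod_cast hij) hx.2⟩
    · exact ((measure_mono inter_subset_left).trans_lt hfin).ne
  obtain ⟨n, hn⟩ := (hlim.eventually (gt_mem_nhds (zero_lt_one (α := ℝ≥0∞)))).exists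
  have hz : m (A n) = 0 := by
    obtain ⟨k, hk⟩ := hm _ (hA n)
    rw [hk] at hn ⊢
    have h1 : k < 1 := by exact_mod_cast hn
    rw [Order.lt_one_iff.1 h1]; simp
  refine IntegrableOn.of_bound (C := n) hfin hg.aestronglyMeasurable ?_
  rw [ae_restrict_iff' hB, ae_iff]
  refine measure_mono_null ?_ hz
  intro x hx
  simp only [mem_ofPred_eq, Classical.not_imp, not_le, Real.norm_eq_abs] at hx
  exact hx

theorem integral_add_mul_add_mul {E : Type*} [MeasurableSpace E] {m : Measure E} {f g k : E → ℝ}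
    (hf : Integrable f m) (hg : Integrable g m) (hk : Integrable k m) (a b : ℝ) :
    ∫ x, (f x + a * g x + b * k x) ∂m = ∫ x, f x ∂m + a * ∫ x, g x ∂m + b * ∫ x, k x ∂m := by
  have h1 : Integrable (fun x => f x + a * g x) m := hf.add (hg.const_mul a)
  rw [integral_add h1 (hk.const_mul b), integral_add hf (hg.const_mul a), integral_const_mul,
    integral_const_mul]

/-! ### Common almost surely convergent subsequences -/

/-- Finitely many sequences converging in measure converge almost everywhere along a common
subsequence. -/
theorem exists_common_seq_tendsto_ae {Ω ι : Type*} [MeasurableSpace Ω] {P : Measure Ω} [Finite ι]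
    {f : ι → ℕ → Ω → ℝ} {F : ι → Ω → ℝ} (hf : ∀ i, TendstoInMeasure P (f i) atTop (F i)) :
    ∃ ns : ℕ → ℕ, StrictMono ns ∧
      ∀ᵐ ω ∂P, ∀ i, Tendsto (fun n => f i (ns n) ω) atTop (𝓝 (F i ω)) := by
  classical
  have := Fintype.ofFinite ι
  suffices h : ∀ s : Finset ι, ∃ ns : ℕ → ℕ, StrictMono ns ∧
      ∀ᵐ ω ∂P, ∀ i ∈ s, Tendsto (fun n => f i (ns n) ω) atTop (𝓝 (F i ω)) by
    simpa using h Finset.univ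
  intro s
  induction s using Finset.induction_on with
  | empty => exact ⟨id, strictMono_id, by simp⟩
  | insert i s _ ih =>
    obtain ⟨ns, hns, hs⟩ := ih
    have h1 : TendstoInMeasure P (fun n => f i (ns n)) atTop (F i) :=
      (hf i).comp hns.tendsto_atTop
    obtain ⟨ms, hms, hi⟩ := h1.exists_seq_tendsto_ae
    refine ⟨ns ∘ ms, hns.comp hms, ?_⟩
    filter_upwards [hs, hi] with ω h2 h3 j hj
    rcases Finset.mem_insert.1 hj with rfl | hj
    · exact h3
    · exact (h2 j hj).comp hms.tendsto_atTop

/-! ### The forward integral with respect to Brownian motion at a random time -/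

/-- The `ε`-approximation of the forward integral of `φ` with respect to `W` up to time `t`. -/
def approxW {Ω : Type*} (W φ : ℝ≥0 → Ω → ℝ) (ε t : ℝ≥0) (ω : Ω) : ℝ :=
  ∫ s in Ioc 0 t, φ s ω * ((W (s + ε) ω - W s ω) / (ε : ℝ)) ∂leb

section BrownianForward

variable {Ω : Type*} [MeasurableSpace Ω] {P : Measure Ω} {W : ℝ≥0 → Ω → ℝ} {T : ℝ≥0}

/-- The integral of a jointly measurable map up to a random time is a random variable. -/
theorem measurable_integral_Ioc {Y : ℝ≥0 × Ω → ℝ} (hY : Measurable Y) {a b : Ω → ℝ≥0}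
    (ha : Measurable a) (hb : Measurable b) :
    Measurable fun ω => ∫ s in Ioc (a ω) (b ω), Y (s, ω) ∂leb := by
  have h1 : Measurable fun p : Ω × ℝ≥0 =>
      {p : Ω × ℝ≥0 | a p.1 < p.2 ∧ p.2 ≤ b p.1}.indicator (fun p => Y (p.2, p.1)) p := by
    have hA : MeasurableSet {p : Ω × ℝ≥0 | a p.1 < p.2} :=
      measurableSet_lt (ha.comp measurable_fst) measurable_snd
    have hB : MeasurableSet {p : Ω × ℝ≥0 | p.2 ≤ b p.1} :=
      measurableSet_le measurable_snd (hb.comp measurable_fst)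
    exact (hY.comp measurable_swap).indicator (hA.inter hB)
  have h2 := h1.stronglyMeasurable.integral_prod_right' (ν := leb)
  convert h2.measurable using 2 with ω
  rw [← integral_indicator measurableSet_Ioc]
  rfl

/-- A left continuous process evaluated at a random time is a random variable. -/
theorem aemeasurable_eval_of_measurable_version {X : ℝ≥0 → Ω → ℝ} {S : Ω → ℝ≥0}
    (hS : Measurable S) (hST : ∀ ω, S ω ≤ T) (hX : ∀ t ≤ T, AEMeasurable (X t) P)
    (hc : ∀ᵐ ω ∂P, ∀ t, 0 < t → t ≤ T → ContinuousWithinAt (X · ω) (Iio t) t) :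
    AEMeasurable (fun ω => X (S ω) ω) P := by
  classical
  obtain ⟨Y, hY, hYX⟩ := exists_measurable_version hX hc
  have h0 := (hX 0 zero_le).ae_eq_mk
  refine ⟨fun ω => if S ω = 0 then (hX 0 zero_le).mk (X 0) ω else Y (S ω, ω),
    Measurable.ite (hS (measurableSet_singleton 0)) (hX 0 zero_le).measurable_mk
      (hY.comp (hS.prodMk measurable_id)), ?_⟩
  filter_upwards [h0, hYX] with ω h1 h2
  split_ifs with h
  · rw [h, h1]
  · rw [h2 _ ⟨pos_iff_ne_zero.2 h, hST ω⟩]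

theorem HasForwardIntegralW.aemeasurable_eval {φ I : ℝ≥0 → Ω → ℝ}
    (h : HasForwardIntegralW P W T φ I) {S : Ω → ℝ≥0} (hS : Measurable S)
    (hST : ∀ ω, S ω ≤ T) : AEMeasurable (fun ω => I (S ω) ω) P := by
  refine aemeasurable_eval_of_measurable_version hS hST (fun t ht => (h.1 t ht).aemeasurable) ?_
  filter_upwards [h.2.1] with ω hω t h0 hT
  refine ((hω t ⟨zero_le, hT⟩).mono_of_mem_nhdsWithin ?_)
  filter_upwards [self_mem_nhdsWithin] with s hs
  exact ⟨zero_le, (le_of_lt hs).trans hT⟩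

theorem aemeasurable_approxW (hW : IsBrownianReal W P) {φ : ℝ≥0 → Ω → ℝ} {Y : ℝ≥0 × Ω → ℝ}
    (hY : Measurable Y) (hYφ : ∀ᵐ ω ∂P, ∀ t ∈ Ioc 0 T, Y (t, ω) = φ t ω) {S : Ω → ℝ≥0}
    (hS : Measurable S) (hST : ∀ ω, S ω ≤ T) (ε : ℝ≥0) :
    AEMeasurable (fun ω => approxW W φ ε (S ω) ω) P := by
  obtain ⟨B, hB, hBW⟩ := exists_measurable_version (P := P) (T := T + ε) (X := W)
    (fun t _ => hW.aemeasurable t)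
    (hW.cont.mono fun ω hω t _ _ => hω.continuousWithinAt)
  have h1 : Measurable fun p : ℝ≥0 × Ω =>
      Y p * ((B (p.1 + ε, p.2) - B p) / (ε : ℝ)) :=
    hY.mul (((hB.comp ((measurable_fst.add_const ε).prodMk measurable_snd)).sub hB).div_const _)
  refine ⟨_, measurable_integral_Ioc h1 (measurable_const (a := 0)) hS, ?_⟩
  filter_upwards [hYφ, hBW] with ω h2 h3
  refine setIntegral_congr_fun measurableSet_Ioc fun s hs => ?_
  have hsT := hs.2.trans (hST ω)
  rw [h2 s ⟨hs.1, hsT⟩, h3 s ⟨hs.1, hsT.trans le_self_add⟩,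
    h3 (s + ε) ⟨hs.1.trans_le le_self_add, add_le_add_left hsT ε⟩]

/-- Convergence in `L¹`, uniformly in time, gives convergence in measure at a random time. -/
theorem HasForwardIntegralW.tendstoInMeasure_eval (hW : IsBrownianReal W P)
    {φ I : ℝ≥0 → Ω → ℝ} (h : HasForwardIntegralW P W T φ I) {Y : ℝ≥0 × Ω → ℝ}
    (hY : Measurable Y) (hYφ : ∀ᵐ ω ∂P, ∀ t ∈ Ioc 0 T, Y (t, ω) = φ t ω) {S : Ω → ℝ≥0}
    (hS : Measurable S) (hST : ∀ ω, S ω ≤ T) :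
    TendstoInMeasure P (fun (n : ℕ) ω => approxW W φ (1 / ((n : ℝ≥0) + 1)) (S ω) ω) atTop
      (fun ω => I (S ω) ω) := by
  refine tendstoInMeasure_of_tendsto_eLpNorm one_ne_zero
    (fun n => (aemeasurable_approxW hW hY hYφ hS hST _).aestronglyMeasurable)
    (h.aemeasurable_eval hS hST).aestronglyMeasurable ?_
  have hε : Tendsto (fun n : ℕ => 1 / ((n : ℝ≥0) + 1)) atTop (𝓝[>] 0) :=
    tendsto_nhdsWithin_iff.2 ⟨tendsto_one_div_add_atTop_nhds_zero_nat (𝕜 := ℝ≥0),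
      Eventually.of_forall fun n => mem_Ioi.2 (by positivity)⟩
  refine tendsto_of_tendsto_of_tendsto_of_le_of_le tendsto_const_nhds (h.2.2.comp hε)
    (fun _ => zero_le) fun n => ?_
  rw [eLpNorm_one_eq_lintegral_enorm]
  refine lintegral_mono fun ω => ?_
  exact le_iSup₂ (f := fun t (_ : t ∈ Icc 0 T) =>
    ‖(∫ s in Ioc 0 t, φ s ω * ((W (s + 1 / ((n : ℝ≥0) + 1)) ω - W s ω) /
      ((1 / ((n : ℝ≥0) + 1) : ℝ≥0) : ℝ)) ∂leb) - I t ω‖ₑ) (S ω) ⟨zero_le, hST ω⟩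

theorem forwardIntW_spec {φ : ℝ≥0 → Ω → ℝ} (h : ForwardIntegrableW P W T φ) :
    HasForwardIntegralW P W T φ (forwardIntW P W T φ) := by
  rw [forwardIntW, dif_pos h]
  exact h.choose_spec

theorem integrableOn_approxW_integrand {φ w : ℝ≥0 → ℝ} (hφ : IsCaglad T φ) (hw : Continuous w)
    (ε : ℝ≥0) {S : ℝ≥0} (hS : S ≤ T) :
    IntegrableOn (fun s => φ s * ((w (s + ε) - w s) / (ε : ℝ))) (Ioc 0 S) leb :=
  (hφ.mul (isCaglad_of_continuous T (by fun_prop))).integrableOn.mono_set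
    (Ioc_subset_Ioc_right hS)

/-- The forward integral is linear, also at a random time: its approximations are linear path by
path and converge almost surely along a common subsequence. -/
theorem forwardIntW_linear (hW : IsBrownianReal W P) {φ : Fin 4 → ℝ≥0 → Ω → ℝ}
    (hφ : ∀ i, ForwardIntegrableW P W T (φ i)) (hcag : ∀ i, ∀ᵐ ω ∂P, IsCaglad T (φ i · ω))
    {Y : Fin 4 → ℝ≥0 × Ω → ℝ} (hY : ∀ i, Measurable (Y i))
    (hYφ : ∀ i, ∀ᵐ ω ∂P, ∀ t ∈ Ioc 0 T, Y i (t, ω) = φ i t ω)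
    {S : Ω → ℝ≥0} (hS : Measurable S) (hST : ∀ ω, S ω ≤ T) {a b : ℝ}
    (hlin : ∀ t ω, φ 0 t ω = φ 1 t ω + a * φ 2 t ω + b * φ 3 t ω) :
    ∀ᵐ ω ∂P, forwardIntW P W T (φ 0) (S ω) ω = forwardIntW P W T (φ 1) (S ω) ω
      + a * forwardIntW P W T (φ 2) (S ω) ω + b * forwardIntW P W T (φ 3) (S ω) ω := by
  obtain ⟨ns, -, hlim⟩ := exists_common_seq_tendsto_ae fun i =>
    (forwardIntW_spec (hφ i)).tendstoInMeasure_eval hW (hY i) (hYφ i) hS hST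
  filter_upwards [hlim, hW.cont, ae_all_iff.2 hcag] with ω h1 h2 h3
  refine tendsto_nhds_unique (h1 0) ?_
  refine (((h1 1).add ((h1 2).const_mul a)).add ((h1 3).const_mul b)).congr fun n => ?_
  have hi := fun i => integrableOn_approxW_integrand (h3 i) h2 (1 / ((ns n : ℝ≥0) + 1)) (hST ω)
  simp only [approxW]
  rw [← integral_add_mul_add_mul (hi 1) (hi 2) (hi 3)]
  refine integral_congr_ae (Eventually.of_forall fun s => ?_)
  simp only [hlin]
  ring

end BrownianForward

/-! ### The concavity gap of the logarithm -/

/-- The amount by which the tangent of `x ↦ ln (1 + x)` at `u` lies above its graph at `v`. -/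
def logGap (u v : ℝ) : ℝ := (v - u) / (1 + u) - (Real.log (1 + v) - Real.log (1 + u))

theorem logGap_eq {u v : ℝ} (hu : 0 < 1 + u) (hv : 0 < 1 + v) :
    logGap u v = (1 + v) / (1 + u) - 1 - Real.log ((1 + v) / (1 + u)) := by
  rw [logGap, Real.log_div hv.ne' hu.ne']
  field_simp
  ring

theorem logGap_nonneg {u v : ℝ} (hu : 0 < 1 + u) (hv : 0 < 1 + v) : 0 ≤ logGap u v := by
  rw [logGap_eq hu hv]
  linarith [Real.log_le_sub_one_of_pos (div_pos hv hu)]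

theorem eq_of_logGap_eq_zero {u v : ℝ} (hu : 0 < 1 + u) (hv : 0 < 1 + v) (h : logGap u v = 0) :
    u = v := by
  by_contra hne
  rw [logGap_eq hu hv] at h
  have := Real.log_lt_sub_one_of_pos (div_pos hv hu) (by
    rw [ne_eq, div_eq_one_iff_eq hu.ne']
    intro h'; exact hne (by linarith))
  linarith

/-- The gap is convex in its second variable and vanishes on the diagonal. -/
theorem logGap_add_mul_le {u b s : ℝ} (hu : 0 < 1 + u) (hv : 0 < 1 + (u + b)) (h0 : 0 ≤ s)
    (h1 : s ≤ 1) : logGap u (u + s * b) ≤ s * logGap u (u + b) := by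
  have h := strictConcaveOn_log_Ioi.concaveOn.2 (mem_Ioi.2 hu) (mem_Ioi.2 hv)
    (sub_nonneg.2 h1) h0 (by ring)
  simp only [smul_eq_mul] at h
  rw [show (1 - s) * (1 + u) + s * (1 + (u + b)) = 1 + (u + s * b) by ring] at h
  simp only [logGap]
  rw [show (u + s * b - u) / (1 + u) = s * ((u + b - u) / (1 + u)) by ring]
  nlinarith

/-- The gap vanishes to first order on the diagonal. -/
theorem tendsto_logGap_div {u b : ℝ} (hu : 0 < 1 + u) {s : ℕ → ℝ} (hs : ∀ n, s n ≠ 0)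
    (hlim : Tendsto s atTop (𝓝 0)) :
    Tendsto (fun n => logGap u (u + s n * b) / s n) atTop (𝓝 0) := by
  have hd : HasDerivAt (fun x : ℝ => Real.log (1 + (u + x * b))) (b / (1 + u)) 0 := by
    have h1 : HasDerivAt (fun x : ℝ => 1 + (u + x * b)) b 0 := by
      simpa using (((hasDerivAt_id (0 : ℝ)).mul_const b).const_add u).const_add 1
    simpa using h1.log (by simpa using hu.ne')
  have h2 : Tendsto s atTop (𝓝[≠] 0) :=
    tendsto_nhdsWithin_iff.2 ⟨hlim, Eventually.of_forall hs⟩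
  have h3 := (hd.tendsto_slope_zero.comp h2).const_sub (b / (1 + u))
  rw [sub_self] at h3
  refine h3.congr fun n => ?_
  simp only [Function.comp_apply, zero_add, zero_mul, add_zero, smul_eq_mul, logGap]
  have := hs n
  have := hu.ne'
  field_simp
  ring

theorem abs_log_one_add_sub_le {x ε : ℝ} (hε : 0 < ε) (hx : ε ≤ 1 + x) :
    |Real.log (1 + x) - x| ≤ x ^ 2 / ε := by
  have h1 : 0 < 1 + x := hε.trans_le hx
  have h2 := Real.log_le_sub_one_of_pos h1
  have h3 := Real.one_sub_inv_le_log_of_pos h1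
  rw [abs_le]
  constructor
  · have h4 : x ^ 2 / (1 + x) ≤ x ^ 2 / ε := div_le_div_of_nonneg_left (sq_nonneg x) hε hx
    have h5 : 1 - (1 + x)⁻¹ - x = -(x ^ 2 / (1 + x)) := by field_simp; ring
    linarith
  · have : 0 ≤ x ^ 2 / ε := by positivity
    linarith

theorem abs_div_one_add_sub_le {x y ε : ℝ} (hε : 0 < ε) (hx : ε ≤ 1 + x) :
    |y / (1 + x) - y| ≤ (x ^ 2 + y ^ 2) / ε := by
  have h1 : 0 < 1 + x := hε.trans_le hx
  have h2 : y / (1 + x) - y = -(x * y) / (1 + x) := by field_simp; ring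
  rw [h2, abs_div, abs_of_pos h1, abs_neg]
  calc |x * y| / (1 + x) ≤ |x * y| / ε := div_le_div_of_nonneg_left (abs_nonneg _) hε hx
    _ ≤ (x ^ 2 + y ^ 2) / ε := by
      gcongr
      rw [abs_le]
      constructor <;> nlinarith [sq_nonneg (x + y), sq_nonneg (x - y)]

/-! ### Compensated jump integrals along one path -/

section JumpIntegral

variable {E : Type*} [MeasurableSpace E] {n l : Measure E} {D : Set E} {Dm : ℕ → Set E}

/-- Passing from the compensated integral of `F` and the compensator of `F - G` to the
uncompensated integral of `F` and the compensator of `G`: only the latter splits into terms that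
are finite on each `Dm m`. -/
theorem tendsto_integral_sub_integral {F G : E → ℝ} (hDm : ∀ m, MeasurableSet (Dm m))
    (hmono : Monotone Dm) (hD : ⋃ m, Dm m = D) (hFG : IntegrableOn (fun x => F x - G x) D l)
    (hG : ∀ m, IntegrableOn G (Dm m) l) {ns : ℕ → ℕ} (hns : StrictMono ns) {j : ℝ}
    (hj : Tendsto (fun k => (∫ x in Dm (ns k), F x ∂n) - ∫ x in Dm (ns k), F x ∂l) atTop (𝓝 j)) :
    Tendsto (fun k => (∫ x in Dm (ns k), F x ∂n) - ∫ x in Dm (ns k), G x ∂l) atTop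
      (𝓝 ((∫ x in D, (F x - G x) ∂l) + j)) := by
  have h1 : Tendsto (fun m => ∫ x in Dm m, (F x - G x) ∂l) atTop
      (𝓝 (∫ x in D, (F x - G x) ∂l)) := by
    have := tendsto_setIntegral_of_monotone hDm hmono (by rw [hD]; exact hFG)
    rwa [hD] at this
  refine ((h1.comp hns.tendsto_atTop).add hj).congr fun k => ?_
  have hsub : Dm (ns k) ⊆ D := hD ▸ subset_iUnion Dm (ns k)
  have hF : IntegrableOn F (Dm (ns k)) l := by
    have := (hFG.mono_set hsub).add (hG (ns k))
    refine this.congr (Eventually.of_forall fun x => ?_)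
    simp
  simp only [Function.comp_apply]
  rw [integral_sub hF (hG (ns k))]
  ring

/-- A non-negative function has the integral `c` over `D` if its integrals over a subsequence of the
exhausting sets tend to `c`. -/
theorem lintegral_eq_ofReal_of_tendsto {f : E → ℝ} (hDm : ∀ m, MeasurableSet (Dm m))
    (hmono : Monotone Dm) (hD : ⋃ m, Dm m = D)
    (hf0 : ∀ x ∈ D, 0 ≤ f x) (hf : ∀ m, IntegrableOn f (Dm m) n) {ns : ℕ → ℕ}
    (hns : StrictMono ns) {c : ℝ}
    (hc : Tendsto (fun k => ∫ x in Dm (ns k), f x ∂n) atTop (𝓝 c)) :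
    ∫⁻ x in D, ENNReal.ofReal (f x) ∂n = ENNReal.ofReal c ∧ 0 ≤ c := by
  have hsub : ∀ m, Dm m ⊆ D := fun m => hD ▸ subset_iUnion Dm m
  constructor
  · have h1 : ∫⁻ x in D, ENNReal.ofReal (f x) ∂n
        = ⨆ m, ∫⁻ x in Dm m, ENNReal.ofReal (f x) ∂n := by
      rw [← hD, setLIntegral_iUnion_of_directed _ hmono.directed_le]
    have h2 : Tendsto (fun m => ∫⁻ x in Dm m, ENNReal.ofReal (f x) ∂n) atTop
        (𝓝 (∫⁻ x in D, ENNReal.ofReal (f x) ∂n)) := by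
      rw [h1]
      exact tendsto_atTop_iSup fun i j hij => lintegral_mono_set (hmono hij)
    refine tendsto_nhds_unique (h2.comp hns.tendsto_atTop)
      ((ENNReal.tendsto_ofReal hc).congr fun k => ?_)
    rw [Function.comp_apply, ofReal_integral_eq_lintegral_ofReal (hf _)]
    exact (ae_restrict_mem (hDm _)).mono fun x hx => hf0 x (hsub _ hx)
  · exact ge_of_tendsto' hc fun k => setIntegral_nonneg (hDm _) fun x hx => hf0 x (hsub _ hx)

/-- The concavity gap of the jump part of the logarithmic wealth. The fields `F i` are `qθ`,
`pθ`, `βθ` and `γθ`, where `q = p + aβ + bγ`, and `J i` is the compensated jump integral of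
`ln (1 + qθ)`, `ln (1 + pθ)`, `βθ / (1 + pθ)`, `γθ / (1 + pθ)` respectively. -/
theorem jump_gap (hDmeas : MeasurableSet D)
    (hDm : ∀ m, MeasurableSet (Dm m)) (hmono : Monotone Dm) (hD : ⋃ m, Dm m = D)
    (hn : ∀ B, MeasurableSet B → ∃ k : ℕ∞, n B = (k : ℝ≥0∞)) (hnD : ∀ m, n (Dm m) < ∞)
    (hlD : ∀ m, l (Dm m) < ∞) {F : Fin 4 → E → ℝ}
    (hF : ∀ i, ∀ m : Measure E, AEMeasurable (F i) (m.restrict D))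
    (hF2 : ∀ i, IntegrableOn (fun x => F i x ^ 2) D l) {ε : ℝ} (hε : 0 < ε)
    (hq : ∀ x ∈ D, ε ≤ 1 + F 0 x) (hp : ∀ x ∈ D, ε ≤ 1 + F 1 x) {a b : ℝ}
    (hlin : ∀ x, F 0 x = F 1 x + a * F 2 x + b * F 3 x) {f : Fin 4 → E → ℝ}
    (hf : f = ![fun x => Real.log (1 + F 0 x), fun x => Real.log (1 + F 1 x),
      fun x => F 2 x / (1 + F 1 x), fun x => F 3 x / (1 + F 1 x)])
    {ns : ℕ → ℕ} (hns : StrictMono ns) {J : Fin 4 → ℝ}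
    (hJ : ∀ i, Tendsto (fun k => (∫ x in Dm (ns k), f i x ∂n) - ∫ x in Dm (ns k), f i x ∂l)
      atTop (𝓝 (J i))) :
    ∫⁻ x in D, ENNReal.ofReal (logGap (F 1 x) (F 0 x)) ∂n < ∞ ∧
    (∫ x in D, (Real.log (1 + F 0 x) - F 0 x) ∂l) + J 0
      = ((∫ x in D, (Real.log (1 + F 1 x) - F 1 x) ∂l) + J 1)
        + a * ((∫ x in D, (F 2 x / (1 + F 1 x) - F 2 x) ∂l) + J 2)
        + b * ((∫ x in D, (F 3 x / (1 + F 1 x) - F 3 x) ∂l) + J 3)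
        - (∫⁻ x in D, ENNReal.ofReal (logGap (F 1 x) (F 0 x)) ∂n).toReal := by
  have hsub : ∀ m, Dm m ⊆ D := fun m => hD ▸ subset_iUnion Dm m
  have hfm : ∀ i, ∀ m : Measure E, AEMeasurable (f i) (m.restrict D) := by
    intro i m
    have h0 := hF 0 m
    have h1 := hF 1 m
    have h2 := hF 2 m
    have h3 := hF 3 m
    rw [hf]
    fin_cases i
    · exact Real.measurable_log.comp_aemeasurable (h0.const_add 1)
    · exact Real.measurable_log.comp_aemeasurable (h1.const_add 1)
    · exact h2.div (h1.const_add 1)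
    · exact h3.div (h1.const_add 1)
  have hfn : ∀ i m, IntegrableOn (f i) (Dm m) n := fun i m =>
    integrableOn_of_integer_valued hn (hDm m) (hnD m)
      ((hfm i n).mono_measure (Measure.restrict_mono_set n (hsub m)))
  have hFl : ∀ i m, IntegrableOn (F i) (Dm m) l := by
    intro i m
    have : IsFiniteMeasure (l.restrict (Dm m)) := ⟨by rw [Measure.restrict_apply_univ]; exact hlD m⟩
    have hm : AEStronglyMeasurable (F i) (l.restrict (Dm m)) :=
      ((hF i l).mono_measure (Measure.restrict_mono_set l (hsub m))).aestronglyMeasurable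
    exact ((memLp_two_iff_integrable_sq hm).2 ((hF2 i).mono_set (hsub m))).integrable one_le_two
  have hdiff : ∀ i, IntegrableOn (fun x => f i x - F i x) D l := by
    intro i
    have hm : AEStronglyMeasurable (fun x => f i x - F i x) (l.restrict D) :=
      ((hfm i l).sub (hF i l)).aestronglyMeasurable
    have hb : IntegrableOn (fun x => (F 1 x ^ 2 + F i x ^ 2) / ε) D l :=
      ((hF2 1).add (hF2 i)).div_const ε
    refine hb.mono' hm ((ae_restrict_mem hDmeas).mono fun x hx => ?_)
    have h0 := abs_log_one_add_sub_le hε (hq x hx)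
    have h1 := abs_log_one_add_sub_le hε (hp x hx)
    rw [Real.norm_eq_abs, hf]
    fin_cases i
    · refine h0.trans (div_le_div_of_nonneg_right ?_ hε.le)
      simp only [Fin.zero_eta, Fin.isValue, le_add_iff_nonneg_left]
      positivity
    · refine h1.trans (div_le_div_of_nonneg_right ?_ hε.le)
      simp only [Fin.mk_one, Fin.isValue, le_add_iff_nonneg_left]
      positivity
    · exact abs_div_one_add_sub_le hε (hp x hx)
    · exact abs_div_one_add_sub_le hε (hp x hx)
  have ht := fun i => tendsto_integral_sub_integral hDm hmono hD (hdiff i) (hFl i) hns (hJ i)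
  have hcomb := (((ht 1).add ((ht 2).const_mul a)).add ((ht 3).const_mul b)).sub (ht 0)
  have hgap : ∀ m, IntegrableOn (fun x => logGap (F 1 x) (F 0 x)) (Dm m) n ∧
      ∫ x in Dm m, logGap (F 1 x) (F 0 x) ∂n
        = (∫ x in Dm m, f 1 x ∂n) + a * (∫ x in Dm m, f 2 x ∂n) + b * (∫ x in Dm m, f 3 x ∂n)
          - ∫ x in Dm m, f 0 x ∂n := by
    intro m
    have hpt : (fun x => logGap (F 1 x) (F 0 x))
        = fun x => (f 1 x + a * f 2 x + b * f 3 x) - f 0 x := by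
      funext x
      have h0 : f 0 x = Real.log (1 + F 0 x) := by rw [hf]; rfl
      have h1 : f 1 x = Real.log (1 + F 1 x) := by rw [hf]; rfl
      have h2 : f 2 x = F 2 x / (1 + F 1 x) := by rw [hf]; rfl
      have h3 : f 3 x = F 3 x / (1 + F 1 x) := by rw [hf]; rfl
      rw [logGap, h0, h1, h2, h3, show F 0 x - F 1 x = a * F 2 x + b * F 3 x by rw [hlin]; ring]
      ring
    have hi : IntegrableOn (fun x => f 1 x + a * f 2 x + b * f 3 x) (Dm m) n :=
      ((hfn 1 m).add ((hfn 2 m).const_mul a)).add ((hfn 3 m).const_mul b)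
    rw [hpt]
    refine ⟨hi.sub (hfn 0 m), ?_⟩
    rw [integral_sub hi (hfn 0 m), integral_add_mul_add_mul (hfn 1 m) (hfn 2 m) (hfn 3 m)]
  have hcomp : ∀ m, ∫ x in Dm m, F 0 x ∂l
      = (∫ x in Dm m, F 1 x ∂l) + a * (∫ x in Dm m, F 2 x ∂l) + b * ∫ x in Dm m, F 3 x ∂l := by
    intro m
    rw [← integral_add_mul_add_mul (hFl 1 m) (hFl 2 m) (hFl 3 m)]
    exact integral_congr_ae (Eventually.of_forall hlin)
  have hlim : Tendsto (fun k => ∫ x in Dm (ns k), logGap (F 1 x) (F 0 x) ∂n) atTop (𝓝 _) :=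
    hcomb.congr fun k => by
      rw [(hgap (ns k)).2, hcomp (ns k)]
      ring
  have hnn : ∀ x ∈ D, 0 ≤ logGap (F 1 x) (F 0 x) := fun x hx =>
    logGap_nonneg (hε.trans_le (hp x hx)) (hε.trans_le (hq x hx))
  obtain ⟨h1, h2⟩ := lintegral_eq_ofReal_of_tendsto hDm hmono hD hnn
    (fun m => (hgap m).1) hns hlim
  rw [h1]
  refine ⟨ENNReal.ofReal_lt_top, ?_⟩
  rw [ENNReal.toReal_ofReal h2, hf]
  simp only [Fin.isValue, Matrix.cons_val_zero, Matrix.cons_val_one, Matrix.cons_val]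
  ring

end JumpIntegral

/-! ### Paths of admissible portfolios -/

theorem tendstoInMeasure_forwardIntN {Ω : Type*} [MeasurableSpace Ω] {P : Measure Ω}
    {N : Ω → Measure (ℝ≥0 × ℝ)} {ν : Measure ℝ} {K : ℕ → Set ℝ} {f : ℝ≥0 → ℝ → Ω → ℝ}
    {S : Ω → ℝ≥0} (h : ∃ J, HasForwardIntegralN P N ν K f S J) :
    TendstoInMeasure P (fun m ω => compensatedInt N ν f (K m) (S ω) ω) atTop
      (forwardIntN P N ν K f S) := by
  rw [forwardIntN, dif_pos h]
  obtain ⟨h1, h2, h3⟩ := h.choose_spec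
  exact tendstoInMeasure_of_tendsto_eLpNorm two_ne_zero (fun m => (h1 m).1) h2.1 h3

theorem aemeasurable_forwardIntN {Ω : Type*} [MeasurableSpace Ω] {P : Measure Ω}
    {N : Ω → Measure (ℝ≥0 × ℝ)} {ν : Measure ℝ} {K : ℕ → Set ℝ} {f : ℝ≥0 → ℝ → Ω → ℝ}
    {S : Ω → ℝ≥0} (h : ∃ J, HasForwardIntegralN P N ν K f S J) :
    AEMeasurable (forwardIntN P N ν K f S) P := by
  rw [forwardIntN, dif_pos h]
  exact h.choose_spec.2.1.1.aemeasurable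

namespace Market

variable {Ω : Type*} [mΩ : MeasurableSpace Ω] {M : Market Ω} {P : Measure Ω}

theorem IsAdmissible.exists_version {p : ℝ≥0 → Ω → ℝ} (hp : M.IsAdmissible P p) :
    ∃ Y : ℝ≥0 × Ω → ℝ, Measurable Y ∧ ∀ᵐ ω ∂P, ∀ t ∈ Ioc 0 M.T, Y (t, ω) = p t ω :=
  exists_measurable_version
    (fun t ht => ((hp.adapted t ht).mono (M.G.le t) le_rfl).aemeasurable)
    (hp.caglad.mono fun _ h => h.1)

/-- Path by path, the products `πθ` are measurable on bounded time intervals. -/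
theorem aemeasurable_mul_theta (hM : M.IsModel P) {p : ℝ≥0 → Ω → ℝ} {ω : Ω}
    (hp : IsCaglad M.T (p · ω)) {S : ℝ≥0} (hS : S ≤ M.T) (V : Set ℝ) (hV : MeasurableSet V)
    (m : Measure (ℝ≥0 × ℝ)) :
    AEMeasurable (fun x : ℝ≥0 × ℝ => p x.1 ω * M.θ x.1 x.2 ω) (m.restrict (Ioc 0 S ×ˢ V)) := by
  have hθ : Measurable fun x : ℝ≥0 × ℝ => M.θ x.1 x.2 ω :=
    hM.θ_meas.comp (measurable_fst.prodMk (measurable_snd.prodMk measurable_const))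
  refine ⟨_, (hp.measurable_indicator.comp measurable_fst).mul hθ, ?_⟩
  refine (ae_restrict_mem (measurableSet_Ioc.prod hV)).mono fun x hx => ?_
  have : x.1 ∈ Ioc 0 M.T := ⟨hx.1.1, hx.1.2.trans hS⟩
  simp [indicator_of_mem this]

theorem IsAdmissible.ae_integrableOn_sq (hM : M.IsModel P) {p : ℝ≥0 → Ω → ℝ}
    (hp : M.IsAdmissible P p) : ∀ᵐ ω ∂P,
      IntegrableOn (fun x : ℝ≥0 × ℝ => (p x.1 ω * M.θ x.1 x.2 ω) ^ 2)
        (Ioc 0 M.T ×ˢ ({0}ᶜ : Set ℝ)) (leb.prod M.ν) := by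
  have := hM.ν_sigmaFinite
  have hD : MeasurableSet (Ioc 0 M.T ×ˢ ({0}ᶜ : Set ℝ)) :=
    measurableSet_Ioc.prod (measurableSet_singleton 0).compl
  obtain ⟨Y, hY, hYp⟩ := hp.exists_version
  have hmeas : AEMeasurable (fun ω => ∫⁻ x in Ioc 0 M.T ×ˢ ({0}ᶜ : Set ℝ),
      ENNReal.ofReal (|M.θ x.1 x.2 ω * p x.1 ω| ^ 2) ∂(leb.prod M.ν)) P := by
    have h1 : Measurable fun y : Ω × (ℝ≥0 × ℝ) =>
        ENNReal.ofReal (|M.θ y.2.1 y.2.2 y.1 * Y (y.2.1, y.1)| ^ 2) := by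
      have hθ : Measurable fun y : Ω × (ℝ≥0 × ℝ) => M.θ y.2.1 y.2.2 y.1 :=
        hM.θ_meas.comp ((measurable_fst.comp measurable_snd).prodMk
          ((measurable_snd.comp measurable_snd).prodMk measurable_fst))
      have hY' : Measurable fun y : Ω × (ℝ≥0 × ℝ) => Y (y.2.1, y.1) :=
        hY.comp ((measurable_fst.comp measurable_snd).prodMk measurable_fst)
      exact (((hθ.mul hY').abs).pow_const 2).ennreal_ofReal
    refine ⟨_, h1.lintegral_prod_right'
      (ν := (leb.prod M.ν).restrict (Ioc 0 M.T ×ˢ ({0}ᶜ : Set ℝ))), ?_⟩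
    filter_upwards [hYp] with ω hω
    refine setLIntegral_congr_fun hD fun x hx => ?_
    rw [hω _ hx.1]
  filter_upwards [ae_lt_top' hmeas hp.integrable_jump.ne, hp.caglad] with ω h1 h2
  refine ⟨((aemeasurable_mul_theta hM h2 le_rfl _ (measurableSet_singleton 0).compl
    _).pow_const 2).aestronglyMeasurable, ?_⟩
  rw [hasFiniteIntegral_iff_ofReal (Eventually.of_forall fun x => sq_nonneg _)]
  refine lt_of_eq_of_lt (lintegral_congr fun x => ?_) h1
  rw [sq_abs, mul_comm]

/-- The quantities `1 + πκ` and `1 + πθ` are bounded away from zero along almost every path. -/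
theorem IsAdmissible.ae_lower_bounds {p : ℝ≥0 → Ω → ℝ} (hp : M.IsAdmissible P p) :
    ∃ ε : ℝ, 0 < ε ∧ ∀ᵐ ω ∂P, ∀ t ≤ M.T,
      ε ≤ 1 + M.κ t ω * p t ω ∧ ∀ z ≠ 0, ε ≤ 1 + p t ω * M.θ t z ω := by
  obtain ⟨ε, hε, h⟩ := hp.lower_bounds
  refine ⟨ε, hε, ?_⟩
  filter_upwards [h] with ω hω t ht
  refine ⟨?_, fun z hz => ?_⟩
  · have := (hω t ht).1; rw [mul_comm]; linarith
  · have := (hω t ht).2 z hz; linarith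

/-! ### The logarithmic wealth and its concavity gap -/

/-- The logarithm of the terminal wealth. -/
def logWealth (M : Market Ω) (P : Measure Ω) (p : ℝ≥0 → Ω → ℝ) (ω : Ω) : ℝ :=
  Real.log M.x₀ + (
    (∫ s in Ioc 0 (M.τ ω),
      (M.ρ s ω + (M.μ s ω - M.ρ s ω) * p s ω - M.σ s ω ^ 2 * p s ω ^ 2 / 2) ∂leb)
    + (∫ x in Ioc 0 (M.τ ω) ×ˢ ({0}ᶜ : Set ℝ),
        (Real.log (1 + p x.1 ω * M.θ x.1 x.2 ω) - p x.1 ω * M.θ x.1 x.2 ω)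
        ∂(leb.prod M.ν))
    + forwardIntW P M.W M.T (fun t ω => p t ω * M.σ t ω) (M.τ ω) ω
    + forwardIntN P M.N M.ν M.K (fun t z ω => Real.log (1 + p t ω * M.θ t z ω)) M.τ ω
    + jumpInt (M.H · ω) (fun s => Real.log (1 + M.κ s ω * p s ω)) 0 (M.τ ω))
  + ∫ s in Ioc (M.τ ω) M.T, M.ρ s ω ∂leb

theorem terminalWealth_eq_exp (hM : M.IsModel P) (p : ℝ≥0 → Ω → ℝ) (ω : Ω) :
    M.terminalWealth P p ω = Real.exp (M.logWealth P p ω) := by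
  rw [logWealth, Real.exp_add, Real.exp_add, Real.exp_log hM.x₀_pos, terminalWealth]

/-- The concavity gap between the logarithmic wealth of `q` and its linearization at `p`. It
collects the quadratic term of the Brownian part and the logarithmic gaps at the jumps of `N`
and of `H`. -/
def wealthGap (M : Market Ω) (p q : ℝ≥0 → Ω → ℝ) (ω : Ω) : ℝ≥0∞ :=
  (∫⁻ s in Ioc 0 (M.τ ω), ENNReal.ofReal (M.σ s ω ^ 2 * (q s ω - p s ω) ^ 2 / 2) ∂leb)
    + (∫⁻ x in Ioc 0 (M.τ ω) ×ˢ ({0}ᶜ : Set ℝ),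
        ENNReal.ofReal (logGap (p x.1 ω * M.θ x.1 x.2 ω) (q x.1 ω * M.θ x.1 x.2 ω)) ∂(M.N ω))
    + ENNReal.ofReal (jumpInt (M.H · ω)
        (fun s => logGap (M.κ s ω * p s ω) (M.κ s ω * q s ω)) 0 (M.τ ω))

theorem ratioField_eq_ratioField_zero (y : ℝ) (β p : ℝ≥0 → Ω → ℝ) :
    M.ratioField y β p = M.ratioField 0 β (p + y • β) := by
  funext t z ω
  simp [ratioField]

theorem Psi_eq_Psi_zero (y : ℝ) (β p : ℝ≥0 → Ω → ℝ) :
    M.Psi P y β p = M.Psi P 0 β (p + y • β) := by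
  funext ω
  simp [Psi, M.ratioField_eq_ratioField_zero y]

/-- The concavity gap of the drift part of the logarithmic wealth, along one path. -/
theorem drift_gap {T S : ℝ≥0} (hS : S ≤ T) {r m s p q u v : ℝ≥0 → ℝ} (hr : IsCaglad T r)
    (hm : IsCaglad T m) (hs : IsCaglad T s) (hp : IsCaglad T p) (hu : IsCaglad T u)
    (hv : IsCaglad T v) {a b : ℝ} (hlin : ∀ t, q t = p t + a * u t + b * v t) :
    ∫⁻ t in Ioc 0 S, ENNReal.ofReal (s t ^ 2 * (q t - p t) ^ 2 / 2) ∂leb < ∞ ∧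
    ∫ t in Ioc 0 S, (r t + (m t - r t) * q t - s t ^ 2 * q t ^ 2 / 2) ∂leb
      = ∫ t in Ioc 0 S, (r t + (m t - r t) * p t - s t ^ 2 * p t ^ 2 / 2) ∂leb
        + a * ∫ t in Ioc 0 S, u t * (m t - r t - p t * s t ^ 2) ∂leb
        + b * ∫ t in Ioc 0 S, v t * (m t - r t - p t * s t ^ 2) ∂leb
        - (∫⁻ t in Ioc 0 S, ENNReal.ofReal (s t ^ 2 * (q t - p t) ^ 2 / 2) ∂leb).toReal := by
  have hs2 : IsCaglad T fun t => s t ^ 2 := by simpa [sq] using hs.mul hs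
  have hp2 : IsCaglad T fun t => p t ^ 2 := by simpa [sq] using hp.mul hp
  have hd : IsCaglad T fun t => a * u t + b * v t := (hu.const_mul a).add (hv.const_mul b)
  have hd2 : IsCaglad T fun t => (a * u t + b * v t) ^ 2 := by simpa [sq] using hd.mul hd
  have hA : IntegrableOn (fun t => r t + (m t - r t) * p t - s t ^ 2 * p t ^ 2 / 2) (Ioc 0 S)
      leb := by
    have h : IsCaglad T fun t => r t + (m t - r t) * p t - s t ^ 2 * p t ^ 2 / 2 := by
      simpa [div_eq_inv_mul, mul_assoc] using
        (hr.add ((hm.sub hr).mul hp)).sub ((hs2.mul hp2).const_mul 2⁻¹)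
    exact h.integrableOn.mono_set (Ioc_subset_Ioc_right hS)
  have hU : IntegrableOn (fun t => u t * (m t - r t - p t * s t ^ 2)) (Ioc 0 S) leb :=
    (hu.mul ((hm.sub hr).sub (hp.mul hs2))).integrableOn.mono_set (Ioc_subset_Ioc_right hS)
  have hV : IntegrableOn (fun t => v t * (m t - r t - p t * s t ^ 2)) (Ioc 0 S) leb :=
    (hv.mul ((hm.sub hr).sub (hp.mul hs2))).integrableOn.mono_set (Ioc_subset_Ioc_right hS)
  have hG : IntegrableOn (fun t => s t ^ 2 * (q t - p t) ^ 2 / 2) (Ioc 0 S) leb := by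
    have h : IsCaglad T fun t => s t ^ 2 * (q t - p t) ^ 2 / 2 := by
      have h1 : (fun t => s t ^ 2 * (q t - p t) ^ 2 / 2)
          = fun t => 2⁻¹ * (s t ^ 2 * (a * u t + b * v t) ^ 2) := by
        funext t
        rw [hlin]
        ring
      rw [h1]
      exact (hs2.mul hd2).const_mul 2⁻¹
    exact h.integrableOn.mono_set (Ioc_subset_Ioc_right hS)
  rw [← ofReal_integral_eq_lintegral_ofReal hG (Eventually.of_forall fun t => by positivity)]
  refine ⟨ENNReal.ofReal_lt_top, ?_⟩
  rw [ENNReal.toReal_ofReal (integral_nonneg fun t => by positivity),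
    ← integral_add_mul_add_mul hA hU hV, ← integral_sub _ hG]
  · refine integral_congr_ae (Eventually.of_forall fun t => ?_)
    simp only [hlin]
    ring
  · exact (hA.add (hU.const_mul a)).add (hV.const_mul b)

/-- The concavity gap of the part of the logarithmic wealth driven by `H`, along one path. -/
theorem counting_gap {T S : ℝ≥0} {h : ℝ≥0 → ℝ} (hh : IsCountingPath T h) {k p q u v : ℝ≥0 → ℝ}
    {a b : ℝ} (hlin : ∀ t, q t = p t + a * u t + b * v t)
    (hp : ∀ t ∈ Ioc 0 S, 0 < 1 + k t * p t) (hq : ∀ t ∈ Ioc 0 S, 0 < 1 + k t * q t) :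
    jumpInt h (fun t => Real.log (1 + k t * q t)) 0 S
      = jumpInt h (fun t => Real.log (1 + k t * p t)) 0 S
        + a * jumpInt h (fun t => u t * k t / (1 + k t * p t)) 0 S
        + b * jumpInt h (fun t => v t * k t / (1 + k t * p t)) 0 S
        - (ENNReal.ofReal (jumpInt h (fun t => logGap (k t * p t) (k t * q t)) 0 S)).toReal := by
  rw [ENNReal.toReal_ofReal (hh.jumpInt_nonneg fun r hr => logGap_nonneg (hp r hr) (hq r hr))]
  simp only [hh.jumpInt_eq_sum]
  rw [Finset.mul_sum, Finset.mul_sum, ← Finset.sum_add_distrib, ← Finset.sum_add_distrib,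
    ← Finset.sum_sub_distrib]
  refine Finset.sum_congr rfl fun r _ => ?_
  simp only [logGap]
  rw [show k r * q r - k r * p r = a * (u r * k r) + b * (v r * k r) by rw [hlin]; ring]
  ring

theorem IsModel.measurable_τ (hM : M.IsModel P) : Measurable M.τ := by
  refine measurable_of_Iic fun t => ?_
  have h := M.G.le t _ (hM.τ_stopping.measurableSet_le t)
  simp only [WithTop.coe_le_coe] at h
  exact h

theorem measurableSet_jumpDomain (S : ℝ≥0) :
    MeasurableSet (Ioc 0 S ×ˢ ({0}ᶜ : Set ℝ)) :=
  measurableSet_Ioc.prod (measurableSet_singleton 0).compl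

/-- The logarithmic wealth is concave in the portfolio, with supergradient `Ψ(0,·,p)` at `p`, and
the defect is `wealthGap`. -/
theorem logWealth_eq_sub_wealthGap [IsProbabilityMeasure P] (hM : M.IsModel P)
    {p q β γ : ℝ≥0 → Ω → ℝ} (hp : M.IsAdmissible P p) (hq : M.IsAdmissible P q)
    (hβ : M.IsAdmissible P β) (hγ : M.IsAdmissible P γ)
    (hRβ : M.ForwardIntegrableNτ P (M.ratioField 0 β p))
    (hRγ : M.ForwardIntegrableNτ P (M.ratioField 0 γ p)) {a b : ℝ}
    (hlin : ∀ t ω, q t ω = p t ω + a * β t ω + b * γ t ω) :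
    ∀ᵐ ω ∂P, M.wealthGap p q ω < ∞ ∧
      M.logWealth P q ω = M.logWealth P p ω + a * M.Psi P 0 β p ω + b * M.Psi P 0 γ p ω
        - (M.wealthGap p q ω).toReal := by
  have hν := hM.ν_sigmaFinite
  have hτm := hM.measurable_τ
  obtain ⟨π, hπ⟩ : ∃ π : Fin 4 → ℝ≥0 → Ω → ℝ, π = ![q, p, β, γ] := ⟨_, rfl⟩
  have h0 : π 0 = q := by rw [hπ]; rfl
  have h1 : π 1 = p := by rw [hπ]; rfl
  have h2 : π 2 = β := by rw [hπ]; rfl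
  have h3 : π 3 = γ := by rw [hπ]; rfl
  have hadm : ∀ i, M.IsAdmissible P (π i) := by
    rw [Fin.forall_fin_succ, Fin.forall_fin_succ, Fin.forall_fin_succ, Fin.forall_fin_one]
    simp only [Fin.succ_zero_eq_one, Fin.succ_one_eq_two]
    exact ⟨h0 ▸ hq, h1 ▸ hp, h2 ▸ hβ, h3 ▸ hγ⟩
  -- the Brownian part is linear
  choose Y hY hYπ using fun i => (hadm i).exists_version
  have hWlin := forwardIntW_linear (P := P) (a := a) (b := b) (S := M.τ) hM.brownian
    (φ := fun i t ω => π i t ω * M.σ t ω) (fun i => (hadm i).forward_σ)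
    (fun i => (hadm i).caglad_σ) (Y := fun i x => Y i x * M.σ x.1 x.2)
    (fun i => (hY i).mul hM.σ_meas)
    (fun i => (hYπ i).mono fun ω hω t ht => by simp only [hω t ht]) hτm hM.τ_le
    (fun t ω => by simp only [h0, h1, h2, h3, hlin]; ring)
  simp only [h0, h1, h2, h3] at hWlin
  -- the jump integrals converge along a common subsequence
  obtain ⟨f, hf⟩ : ∃ f : Fin 4 → ℝ≥0 → ℝ → Ω → ℝ, f =
      ![fun t z ω => Real.log (1 + q t ω * M.θ t z ω),
        fun t z ω => Real.log (1 + p t ω * M.θ t z ω), M.ratioField 0 β p,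
        M.ratioField 0 γ p] := ⟨_, rfl⟩
  have hJex : ∀ i, ∃ J, HasForwardIntegralN P M.N M.ν M.K (f i) M.τ J := by
    rw [Fin.forall_fin_succ, Fin.forall_fin_succ, Fin.forall_fin_succ, Fin.forall_fin_one, hf]
    exact ⟨hq.forward_log.2, hp.forward_log.2, hRβ.2, hRγ.2⟩
  obtain ⟨ns, hns, hJ⟩ := exists_common_seq_tendsto_ae fun i =>
    tendstoInMeasure_forwardIntN (hJex i)
  obtain ⟨εp, hεp, hlbp⟩ := hp.ae_lower_bounds
  obtain ⟨εq, hεq, hlbq⟩ := hq.ae_lower_bounds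
  have hKmeas : ∀ m, MeasurableSet (M.K m) := fun m => (hM.K_compact m).isClosed.measurableSet
  have hDmeas : ∀ S m, MeasurableSet (Ioc (0 : ℝ≥0) S ×ˢ M.K m) := fun S m =>
    measurableSet_Ioc.prod (hKmeas m)
  have hlfin : ∀ S m, (leb.prod M.ν) (Ioc 0 S ×ˢ M.K m) < ∞ := fun S m => by
    rw [Measure.prod_prod, leb_Ioc]
    exact ENNReal.mul_lt_top ENNReal.ofReal_lt_top (hM.K_finite m)
  have hNfin : ∀ᵐ ω ∂P, ∀ m, M.N ω (Ioc 0 M.T ×ˢ M.K m) < ∞ := ae_all_iff.2 fun m =>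
    hM.poisson.ae_lt_top (hDmeas M.T m) (hlfin M.T m).ne
  filter_upwards [hWlin, hJ, hlbp, hlbq, hNfin, hM.poisson.integer_valued,
    ae_all_iff.2 fun i => (hadm i).ae_integrableOn_sq hM, ae_all_iff.2 fun i => (hadm i).caglad,
    hM.ρ_caglad, hM.μ_caglad, hM.σ_caglad, hM.counting.ae_isCountingPath]
    with ω hW hJ hlp hlq hNf hNi hsq hcag hρ hμ hσ hH
  have hτ := hM.τ_le ω
  obtain ⟨hd1, hd⟩ := drift_gap (q := (q · ω)) (a := a) (b := b) hτ hρ hμ hσ (h1 ▸ hcag 1)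
    (h2 ▸ hcag 2) (h3 ▸ hcag 3) (fun t => hlin t ω)
  have hc := counting_gap (S := M.τ ω) (k := (M.κ · ω)) (p := (p · ω)) (q := (q · ω)) (a := a)
    (b := b) hH (fun t => hlin t ω)
    (fun t ht => hεp.trans_le (hlp t (ht.2.trans hτ)).1)
    (fun t ht => hεq.trans_le (hlq t (ht.2.trans hτ)).1)
  have hsub : Ioc 0 (M.τ ω) ×ˢ ({0}ᶜ : Set ℝ) ⊆ Ioc 0 M.T ×ˢ ({0}ᶜ : Set ℝ) :=
    prod_mono (Ioc_subset_Ioc_right hτ) le_rfl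
  have hj := jump_gap (E := ℝ≥0 × ℝ) (n := M.N ω) (l := leb.prod M.ν)
    (D := Ioc 0 (M.τ ω) ×ˢ ({0}ᶜ : Set ℝ)) (Dm := fun m => Ioc 0 (M.τ ω) ×ˢ M.K m)
    (measurableSet_jumpDomain _) (hDmeas _) (fun i j hij => prod_mono le_rfl (hM.K_mono hij))
    (by rw [← prod_iUnion, hM.K_iUnion]) hNi
    (fun m => (measure_mono (prod_mono (Ioc_subset_Ioc_right hτ) le_rfl)).trans_lt (hNf m))
    (hlfin _) (F := fun i x => π i x.1 ω * M.θ x.1 x.2 ω)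
    (fun i m => aemeasurable_mul_theta hM (hcag i) hτ _ (measurableSet_singleton 0).compl m)
    (fun i => (hsq i).mono_set hsub) (lt_min hεp hεq)
    (fun x hx => (min_le_right _ _).trans
      (by rw [h0]; exact (hlq x.1 (hx.1.2.trans hτ)).2 x.2 hx.2))
    (fun x hx => (min_le_left _ _).trans
      (by rw [h1]; exact (hlp x.1 (hx.1.2.trans hτ)).2 x.2 hx.2)) (a := a) (b := b)
    (fun x => by simp only [h0, h1, h2, h3, hlin]; ring) (f := fun i x => f i x.1 x.2 ω)
    (by
      rw [hf]
      funext i x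
      simp only [h0, h1, h2, h3]
      fin_cases i <;> simp [ratioField]) hns
    (J := fun i => forwardIntN P M.N M.ν M.K (f i) M.τ ω) hJ
  simp only [h0, h1, h2, h3] at hj
  simp only [hf, Matrix.cons_val_zero, Matrix.cons_val_one, Matrix.cons_val] at hj
  obtain ⟨hj1, hj2⟩ := hj
  refine ⟨ENNReal.add_lt_top.2 ⟨ENNReal.add_lt_top.2 ⟨hd1, hj1⟩, ENNReal.ofReal_lt_top⟩, ?_⟩
  rw [wealthGap, ENNReal.toReal_add (ENNReal.add_lt_top.2 ⟨hd1, hj1⟩).ne ENNReal.ofReal_ne_top,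
    ENNReal.toReal_add hd1.ne hj1.ne]
  simp only [logWealth, Psi, zero_mul, add_zero, ratioField] at hj2 ⊢
  linarith

end Market

/-! ### Measurability of the logarithmic wealth and size of the gap -/

theorem measurable_integral_jumpDomain {Ω : Type*} [MeasurableSpace Ω] {ν : Measure ℝ}
    [SigmaFinite ν] {F : (ℝ≥0 × ℝ) × Ω → ℝ} (hF : Measurable F) {S : Ω → ℝ≥0}
    (hS : Measurable S) :
    Measurable fun ω => ∫ x in Ioc 0 (S ω) ×ˢ ({0}ᶜ : Set ℝ), F (x, ω) ∂(leb.prod ν) := by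
  have h1 : Measurable fun p : Ω × (ℝ≥0 × ℝ) =>
      {p : Ω × (ℝ≥0 × ℝ) | (0 < p.2.1 ∧ p.2.1 ≤ S p.1) ∧ p.2.2 ∈ ({0}ᶜ : Set ℝ)}.indicator
        (fun p => F (p.2, p.1)) p := by
    have hA : MeasurableSet {p : Ω × (ℝ≥0 × ℝ) | 0 < p.2.1} :=
      measurableSet_lt measurable_const (measurable_fst.comp measurable_snd)
    have hB : MeasurableSet {p : Ω × (ℝ≥0 × ℝ) | p.2.1 ≤ S p.1} :=
      measurableSet_le (measurable_fst.comp measurable_snd) (hS.comp measurable_fst)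
    have hC : MeasurableSet {p : Ω × (ℝ≥0 × ℝ) | p.2.2 ∈ ({0}ᶜ : Set ℝ)} :=
      (measurable_snd.comp measurable_snd) (measurableSet_singleton 0).compl
    exact (hF.comp measurable_swap).indicator ((hA.inter hB).inter hC)
  have h2 := h1.stronglyMeasurable.integral_prod_right' (ν := leb.prod ν)
  convert h2.measurable using 2 with ω
  rw [← integral_indicator (Market.measurableSet_jumpDomain _)]
  rfl

namespace Market

variable {Ω : Type*} [mΩ : MeasurableSpace Ω] {M : Market Ω} {P : Measure Ω}

theorem aemeasurable_logWealth (hM : M.IsModel P) {p : ℝ≥0 → Ω → ℝ}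
    (hp : M.IsAdmissible P p) : AEMeasurable (M.logWealth P p) P := by
  have hν := hM.ν_sigmaFinite
  have hτm := hM.measurable_τ
  obtain ⟨Y, hY, hYp⟩ := hp.exists_version
  have hY' : ∀ᵐ ω ∂P, ∀ t ∈ Ioc 0 (M.τ ω), Y (t, ω) = p t ω :=
    hYp.mono fun ω hω t ht => hω t ⟨ht.1, ht.2.trans (hM.τ_le ω)⟩
  have h1 : AEMeasurable (fun ω => ∫ s in Ioc 0 (M.τ ω),
      (M.ρ s ω + (M.μ s ω - M.ρ s ω) * p s ω - M.σ s ω ^ 2 * p s ω ^ 2 / 2) ∂leb) P := by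
    have hF : Measurable fun x : ℝ≥0 × Ω => M.ρ x.1 x.2 + (M.μ x.1 x.2 - M.ρ x.1 x.2) * Y x
        - M.σ x.1 x.2 ^ 2 * Y x ^ 2 / 2 :=
      (hM.ρ_meas.add ((hM.μ_meas.sub hM.ρ_meas).mul hY)).sub
        (((hM.σ_meas.pow_const 2).mul (hY.pow_const 2)).div_const 2)
    refine ⟨_, measurable_integral_Ioc hF (measurable_const (a := 0)) hτm, ?_⟩
    filter_upwards [hY'] with ω hω
    exact setIntegral_congr_fun measurableSet_Ioc fun s hs => by simp only [hω s hs]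
  have h2 : AEMeasurable (fun ω => ∫ x in Ioc 0 (M.τ ω) ×ˢ ({0}ᶜ : Set ℝ),
      (Real.log (1 + p x.1 ω * M.θ x.1 x.2 ω) - p x.1 ω * M.θ x.1 x.2 ω)
        ∂(leb.prod M.ν)) P := by
    have hF : Measurable fun x : (ℝ≥0 × ℝ) × Ω => Y (x.1.1, x.2) * M.θ x.1.1 x.1.2 x.2 :=
      (hY.comp ((measurable_fst.comp measurable_fst).prodMk measurable_snd)).mul
        (hM.θ_meas.comp ((measurable_fst.comp measurable_fst).prodMk
          ((measurable_snd.comp measurable_fst).prodMk measurable_snd)))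
    refine ⟨_, measurable_integral_jumpDomain (ν := M.ν)
      ((Real.measurable_log.comp (hF.const_add 1)).sub hF) hτm, ?_⟩
    filter_upwards [hY'] with ω hω
    exact setIntegral_congr_fun (measurableSet_jumpDomain _) fun x hx => by
      simp only [Pi.sub_apply, Function.comp_apply, hω x.1 hx.1]
  have h3 := (forwardIntW_spec hp.forward_σ).aemeasurable_eval hτm hM.τ_le
  have h4 := aemeasurable_forwardIntN hp.forward_log.2
  have h5 : AEMeasurable (fun ω => jumpInt (M.H · ω)
      (fun s => Real.log (1 + M.κ s ω * p s ω)) 0 (M.τ ω)) P :=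
    aemeasurable_jumpInt hM.counting hτm hM.τ_le
      (g := fun s ω => Real.log (1 + M.κ s ω * p s ω))
      (Real.measurable_log.comp ((hM.κ_meas.mul hY).const_add 1))
      (hYp.mono fun ω hω t ht => by simp [Function.uncurry, hω t ht])
  have h6 : Measurable fun ω => ∫ s in Ioc (M.τ ω) M.T, M.ρ s ω ∂leb :=
    measurable_integral_Ioc hM.ρ_meas hτm measurable_const
  exact (((((h1.add h2).add h3).add h4).add h5).const_add _).add h6.aemeasurable

/-- The concavity gap is of smaller order than the step of the perturbation. -/
theorem tendsto_wealthGap_div (hM : M.IsModel P) {p q : ℝ≥0 → Ω → ℝ} (hp : M.IsAdmissible P p)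
    (hq : M.IsAdmissible P q) (hfin : ∀ᵐ ω ∂P, M.wealthGap p q ω < ∞) {s : ℕ → ℝ}
    (hs0 : ∀ n, 0 < s n) (hs1 : ∀ n, s n ≤ 1) (hs : Tendsto s atTop (𝓝 0)) :
    ∀ᵐ ω ∂P, Tendsto (fun n => (M.wealthGap p (p + s n • (q - p)) ω).toReal / s n) atTop
      (𝓝 0) := by
  obtain ⟨εp, hεp, hlbp⟩ := hp.ae_lower_bounds
  obtain ⟨εq, hεq, hlbq⟩ := hq.ae_lower_bounds
  filter_upwards [hfin, hlbp, hlbq, hp.caglad, hq.caglad, hM.counting.ae_isCountingPath]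
    with ω hfin hlp hlq hcp hcq hH
  have hτ := hM.τ_le ω
  rw [wealthGap] at hfin
  obtain ⟨hf1, hf3⟩ := ENNReal.add_lt_top.1 hfin
  obtain ⟨hf1, hf2⟩ := ENNReal.add_lt_top.1 hf1
  have hr : ∀ n, ENNReal.ofReal (s n)⁻¹ ≠ ∞ := fun n => ENNReal.ofReal_ne_top
  have hinv : ∀ n, 0 ≤ (s n)⁻¹ := fun n => (inv_pos.2 (hs0 n)).le
  -- the quadratic term carries the factor `s ^ 2`
  have h1 : Tendsto (fun n => ENNReal.ofReal (s n)⁻¹ * ∫⁻ t in Ioc 0 (M.τ ω),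
      ENNReal.ofReal (M.σ t ω ^ 2 * ((p + s n • (q - p)) t ω - p t ω) ^ 2 / 2) ∂leb) atTop
      (𝓝 0) := by
    have h := ENNReal.Tendsto.mul_const (ENNReal.tendsto_ofReal hs) (Or.inr hf1.ne)
    rw [ENNReal.ofReal_zero, zero_mul] at h
    refine h.congr fun n => ?_
    rw [← lintegral_const_mul' _ _ ENNReal.ofReal_ne_top, ← lintegral_const_mul' _ _ (hr n)]
    refine lintegral_congr fun t => ?_
    rw [← ENNReal.ofReal_mul (hs0 n).le, ← ENNReal.ofReal_mul (hinv n)]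
    congr 1
    have := (hs0 n).ne'
    simp only [Pi.add_apply, Pi.smul_apply, Pi.sub_apply, smul_eq_mul]
    field_simp
    ring
  -- at the jumps of `N` the gap is dominated by convexity
  have h2 : Tendsto (fun n => ENNReal.ofReal (s n)⁻¹ *
      ∫⁻ x in Ioc 0 (M.τ ω) ×ˢ ({0}ᶜ : Set ℝ), ENNReal.ofReal (logGap (p x.1 ω * M.θ x.1 x.2 ω)
        ((p + s n • (q - p)) x.1 ω * M.θ x.1 x.2 ω)) ∂(M.N ω)) atTop (𝓝 0) := by
    have hmp := aemeasurable_mul_theta hM hcp hτ _ (measurableSet_singleton 0).compl (M.N ω)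
    have hmq := aemeasurable_mul_theta hM hcq hτ _ (measurableSet_singleton 0).compl (M.N ω)
    have hval : ∀ n (x : ℝ≥0 × ℝ), (p + s n • (q - p)) x.1 ω * M.θ x.1 x.2 ω
        = p x.1 ω * M.θ x.1 x.2 ω
          + s n * (q x.1 ω * M.θ x.1 x.2 ω - p x.1 ω * M.θ x.1 x.2 ω) := by
      intro n x
      simp only [Pi.add_apply, Pi.smul_apply, Pi.sub_apply, smul_eq_mul]
      ring
    simp_rw [hval, ← lintegral_const_mul' _ _ (hr _), ← ENNReal.ofReal_mul (hinv _)]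
    rw [← lintegral_zero (α := ℝ≥0 × ℝ)
      (μ := (M.N ω).restrict (Ioc 0 (M.τ ω) ×ˢ ({0}ᶜ : Set ℝ)))]
    refine tendsto_lintegral_of_dominated_convergence' (fun x : ℝ≥0 × ℝ => ENNReal.ofReal
      (logGap (p x.1 ω * M.θ x.1 x.2 ω) (q x.1 ω * M.θ x.1 x.2 ω))) (fun n => ?_) (fun n => ?_)
      hf2.ne ?_
    · have hm := hmp.add ((hmq.sub hmp).const_mul (s n))
      exact (((((hm.sub hmp).div (hmp.const_add 1)).sub
        ((Real.measurable_log.comp_aemeasurable (hm.const_add 1)).sub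
          (Real.measurable_log.comp_aemeasurable (hmp.const_add 1)))).const_mul _)).ennreal_ofReal
    · refine (ae_restrict_mem (measurableSet_jumpDomain _)).mono fun x hx => ?_
      have hu := hεp.trans_le ((hlp x.1 (hx.1.2.trans hτ)).2 x.2 hx.2)
      have hv := hεq.trans_le ((hlq x.1 (hx.1.2.trans hτ)).2 x.2 hx.2)
      refine ENNReal.ofReal_le_ofReal ?_
      have h := logGap_add_mul_le (b := q x.1 ω * M.θ x.1 x.2 ω - p x.1 ω * M.θ x.1 x.2 ω) hu
        (by rw [add_sub_cancel]; exact hv) (hs0 n).le (hs1 n)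
      rw [add_sub_cancel] at h
      rw [inv_mul_le_iff₀ (hs0 n)]
      exact h
    · refine (ae_restrict_mem (measurableSet_jumpDomain _)).mono fun x hx => ?_
      have hu := hεp.trans_le ((hlp x.1 (hx.1.2.trans hτ)).2 x.2 hx.2)
      rw [← ENNReal.ofReal_zero]
      refine ENNReal.tendsto_ofReal ((tendsto_logGap_div
        (b := q x.1 ω * M.θ x.1 x.2 ω - p x.1 ω * M.θ x.1 x.2 ω) hu (fun n => (hs0 n).ne') hs).congr
        fun n => ?_)
      rw [div_eq_inv_mul]
  -- there are finitely many jumps of `H`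
  have h3 : Tendsto (fun n => ENNReal.ofReal (s n)⁻¹ * ENNReal.ofReal (jumpInt (M.H · ω)
      (fun t => logGap (M.κ t ω * p t ω) (M.κ t ω * (p + s n • (q - p)) t ω)) 0 (M.τ ω))) atTop
      (𝓝 0) := by
    simp_rw [← ENNReal.ofReal_mul (hinv _), hH.jumpInt_eq_sum, Finset.mul_sum]
    rw [← ENNReal.ofReal_zero]
    refine ENNReal.tendsto_ofReal ?_
    rw [← Finset.sum_const_zero (s := hH.jumps (M.τ ω))]
    refine tendsto_finsetSum _ fun r hr => ?_
    have hrτ := (hH.mem_jumps.1 hr).1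
    have hu := hεp.trans_le (hlp r (hrτ.2.trans hτ)).1
    have h := (tendsto_logGap_div (b := M.κ r ω * q r ω - M.κ r ω * p r ω) hu
      (fun n => (hs0 n).ne') hs).mul_const (jump (M.H · ω) r)
    rw [zero_mul] at h
    refine h.congr fun n => ?_
    rw [div_eq_inv_mul, mul_assoc]
    congr 3
    simp only [Pi.add_apply, Pi.smul_apply, Pi.sub_apply, smul_eq_mul]
    ring
  have h := (h1.add h2).add h3
  simp only [← mul_add, add_zero] at h
  have h' := (ENNReal.tendsto_toReal ENNReal.zero_ne_top).comp h
  rw [ENNReal.toReal_zero] at h'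
  refine h'.congr fun n => ?_
  rw [Function.comp_apply, ENNReal.toReal_mul, ENNReal.toReal_ofReal (hinv n), div_eq_inv_mul]
  rfl

/-- If the concavity gap vanishes, then the two portfolios agree wherever there is noise. -/
theorem eq_of_wealthGap_eq_zero (hM : M.IsModel P) {p q : ℝ≥0 → Ω → ℝ}
    (hp : M.IsAdmissible P p) (hq : M.IsAdmissible P q)
    (h0 : ∀ᵐ ω ∂P, M.wealthGap p q ω = 0) : ∀ᵐ ω ∂P,
      (∀ᵐ t ∂leb.restrict (Ioc 0 (M.τ ω)), M.σ t ω ≠ 0 → p t ω = q t ω) ∧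
      (∀ᵐ x ∂(M.N ω).restrict (Ioc 0 (M.τ ω) ×ˢ ({0}ᶜ : Set ℝ)),
        M.θ x.1 x.2 ω ≠ 0 → p x.1 ω = q x.1 ω) ∧
      ∀ t ∈ Ioc 0 (M.τ ω), M.κ t ω * jump (M.H · ω) t ≠ 0 → p t ω = q t ω := by
  obtain ⟨εp, hεp, hlbp⟩ := hp.ae_lower_bounds
  obtain ⟨εq, hεq, hlbq⟩ := hq.ae_lower_bounds
  filter_upwards [h0, hlbp, hlbq, hp.caglad, hq.caglad, hM.counting.ae_isCountingPath,
    hM.σ_caglad] with ω h0 hlp hlq hcp hcq hH hσ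
  have hτ := hM.τ_le ω
  simp only [wealthGap, add_eq_zero] at h0
  obtain ⟨⟨h1, h2⟩, h3⟩ := h0
  refine ⟨?_, ?_, ?_⟩
  · have hm : ∀ {f : ℝ≥0 → ℝ}, IsCaglad M.T f →
        AEMeasurable f (leb.restrict (Ioc 0 (M.τ ω))) := fun hf =>
      (aemeasurable_of_measurable_indicator measurableSet_Ioc
        hf.measurable_indicator).mono_measure
          (Measure.restrict_mono_set leb (Ioc_subset_Ioc_right hτ))
    have hmeas : AEMeasurable (fun t => ENNReal.ofReal (M.σ t ω ^ 2 * (q t ω - p t ω) ^ 2 / 2))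
        (leb.restrict (Ioc 0 (M.τ ω))) := ((((hm hσ).pow_const 2).mul
      (((hm hcq).sub (hm hcp)).pow_const 2)).div_const 2).ennreal_ofReal
    rw [lintegral_eq_zero_iff' hmeas] at h1
    filter_upwards [h1] with t ht hσt
    have h : M.σ t ω ^ 2 * (q t ω - p t ω) ^ 2 / 2 ≤ 0 := by simpa using ht
    have h4 : 0 < M.σ t ω ^ 2 := by positivity
    have h5 : (q t ω - p t ω) ^ 2 = 0 :=
      le_antisymm (by
        by_contra! hc
        have := mul_pos h4 hc
        linarith) (sq_nonneg _)
    have h6 := pow_eq_zero_iff two_ne_zero |>.1 h5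
    linarith
  · have hmp := aemeasurable_mul_theta hM hcp hτ _ (measurableSet_singleton 0).compl (M.N ω)
    have hmq := aemeasurable_mul_theta hM hcq hτ _ (measurableSet_singleton 0).compl (M.N ω)
    have hmeas : AEMeasurable (fun x : ℝ≥0 × ℝ => ENNReal.ofReal
        (logGap (p x.1 ω * M.θ x.1 x.2 ω) (q x.1 ω * M.θ x.1 x.2 ω)))
        ((M.N ω).restrict (Ioc 0 (M.τ ω) ×ˢ ({0}ᶜ : Set ℝ))) :=
      (((hmq.sub hmp).div (hmp.const_add 1)).sub
        ((Real.measurable_log.comp_aemeasurable (hmq.const_add 1)).sub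
          (Real.measurable_log.comp_aemeasurable (hmp.const_add 1)))).ennreal_ofReal
    rw [lintegral_eq_zero_iff' hmeas] at h2
    filter_upwards [h2, ae_restrict_mem (measurableSet_jumpDomain _)] with x hx hxD hθ
    have hu := hεp.trans_le ((hlp x.1 (hxD.1.2.trans hτ)).2 x.2 hxD.2)
    have hv := hεq.trans_le ((hlq x.1 (hxD.1.2.trans hτ)).2 x.2 hxD.2)
    have h : logGap (p x.1 ω * M.θ x.1 x.2 ω) (q x.1 ω * M.θ x.1 x.2 ω) ≤ 0 := by
      simpa using hx
    exact mul_right_cancel₀ hθ (eq_of_logGap_eq_zero hu hv (le_antisymm h (logGap_nonneg hu hv)))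
  · intro t ht hne
    have hu := fun r (hr : r ∈ Ioc 0 (M.τ ω)) => hεp.trans_le (hlp r (hr.2.trans hτ)).1
    have hv := fun r (hr : r ∈ Ioc 0 (M.τ ω)) => hεq.trans_le (hlq r (hr.2.trans hτ)).1
    have hnn : ∀ r ∈ hH.jumps (M.τ ω), 0 ≤ logGap (M.κ r ω * p r ω) (M.κ r ω * q r ω)
        * jump (M.H · ω) r := fun r hr =>
      mul_nonneg (logGap_nonneg (hu r (hH.mem_jumps.1 hr).1) (hv r (hH.mem_jumps.1 hr).1))
        (hH.jump_nonneg r)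
    have hsum := ENNReal.ofReal_eq_zero.1 h3
    rw [hH.jumpInt_eq_sum] at hsum
    have hz := (Finset.sum_eq_zero_iff_of_nonneg hnn).1
      (le_antisymm hsum (Finset.sum_nonneg hnn)) t
      (hH.mem_jumps.2 ⟨ht, right_ne_zero_of_mul hne⟩)
    have hg := (mul_eq_zero.1 hz).resolve_right (right_ne_zero_of_mul hne)
    exact mul_left_cancel₀ (left_ne_zero_of_mul hne) (eq_of_logGap_eq_zero (hu t ht) (hv t ht) hg)

end Market

/-! ### Utility of the logarithmic wealth and the first order condition -/

theorem hasDerivAt_comp_exp {U : ℝ → ℝ} (hU : ∀ x, 0 < x → DifferentiableAt ℝ U x) (a : ℝ) :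
    HasDerivAt (fun x => U (Real.exp x)) (deriv U (Real.exp a) * Real.exp a) a :=
  (hU _ (Real.exp_pos a)).hasDerivAt.comp a (Real.hasDerivAt_exp a)

/-- The condition `x U''(x) + U'(x) ≤ 0` says that `U ∘ exp` is concave. -/
theorem concaveOn_comp_exp {U : ℝ → ℝ} (hU : ∀ x, 0 < x → DifferentiableAt ℝ U x)
    (hU' : ∀ x, 0 < x → DifferentiableAt ℝ (deriv U) x)
    (hU'' : ∀ x, 0 < x → x * deriv (deriv U) x + deriv U x ≤ 0) :
    ConcaveOn ℝ univ fun x => U (Real.exp x) := by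
  refine Antitone.concaveOn_univ_of_deriv (fun a => (hasDerivAt_comp_exp hU a).differentiableAt) ?_
  have hd : deriv (fun x => U (Real.exp x)) = fun a => deriv U (Real.exp a) * Real.exp a :=
    funext fun a => (hasDerivAt_comp_exp hU a).deriv
  have h2 : ∀ a, HasDerivAt (fun a => deriv U (Real.exp a) * Real.exp a)
      (deriv (deriv U) (Real.exp a) * Real.exp a * Real.exp a + deriv U (Real.exp a) * Real.exp a)
      a := fun a => (hasDerivAt_comp_exp (U := deriv U) hU' a).mul (Real.hasDerivAt_exp a)
  rw [hd]
  refine antitone_of_deriv_nonpos (fun a => (h2 a).differentiableAt) fun a => ?_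
  rw [(h2 a).deriv]
  nlinarith [hU'' _ (Real.exp_pos a), Real.exp_pos a]

theorem strictMono_comp_exp {U : ℝ → ℝ} (hU : StrictMonoOn U (Ioi 0)) :
    StrictMono fun x => U (Real.exp x) := fun _ _ h =>
  hU (Real.exp_pos _) (Real.exp_pos _) (Real.exp_lt_exp.2 h)

theorem _root_.ConcaveOn.le_add_mul_of_hasDerivAt {V : ℝ → ℝ} (hV : ConcaveOn ℝ univ V)
    {a d : ℝ} (hd : HasDerivAt V d a) (b : ℝ) : V b ≤ V a + d * (b - a) := by
  rcases lt_trichotomy a b with h | rfl | h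
  · have := hV.slope_le_of_hasDerivAt trivial trivial h hd
    rw [slope_def_field, div_le_iff₀ (sub_pos.2 h)] at this
    linarith
  · simp
  · have := hV.le_slope_of_hasDerivAt trivial trivial h hd
    rw [slope_def_field, le_div_iff₀ (sub_pos.2 h)] at this
    linarith

/-- Chain rule for difference quotients along a sequence `x n ≈ a + s n * r`. -/
theorem _root_.HasDerivAt.tendsto_div_of_tendsto_div {V : ℝ → ℝ} {a d r : ℝ}
    (hV : HasDerivAt V d a) {s x : ℕ → ℝ} (hs0 : ∀ n, s n ≠ 0) (hs : Tendsto s atTop (𝓝 0))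
    (hx : Tendsto (fun n => (x n - a) / s n) atTop (𝓝 r)) :
    Tendsto (fun n => (V (x n) - V a) / s n) atTop (𝓝 (d * r)) := by
  have hxa : Tendsto x atTop (𝓝 a) := by
    have h := (hs.mul hx).const_add a
    rw [zero_mul, add_zero] at h
    refine h.congr fun n => ?_
    rw [mul_div_cancel₀ _ (hs0 n)]
    ring
  have hc : ContinuousAt (dslope V a) a := continuousAt_dslope_same.2 hV.differentiableAt
  have h1 := (hc.tendsto.comp hxa).mul hx
  rw [dslope_same, hV.deriv] at h1
  refine h1.congr fun n => ?_
  have h2 := sub_smul_dslope V a (x n)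
  rw [smul_eq_mul] at h2
  rw [Function.comp_apply, ← h2]
  ring

namespace Market

variable {Ω : Type*} [mΩ : MeasurableSpace Ω] {M : Market Ω} {P : Measure Ω}

theorem expectedUtility_eq_integral {U : ℝ → ℝ} {p : ℝ≥0 → Ω → ℝ}
    (h : Integrable (fun ω => U (M.terminalWealth P p ω)) P) :
    M.expectedUtility P U p = ((∫ ω, U (M.terminalWealth P p ω) ∂P : ℝ) : EReal) := by
  have h1 : ∫⁻ ω, ENNReal.ofReal (U (M.terminalWealth P p ω)) ∂P ≠ ∞ :=
    h.lintegral_lt_top.ne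
  have h2 : ∫⁻ ω, ENNReal.ofReal (-U (M.terminalWealth P p ω)) ∂P ≠ ∞ :=
    h.neg.lintegral_lt_top.ne
  rw [expectedUtility, integral_eq_lintegral_pos_part_sub_lintegral_neg_part h, EReal.coe_sub,
    EReal.coe_ennreal_toReal h1, EReal.coe_ennreal_toReal h2]

/-- The marginal utility `U'(X_p(T)) X_p(T) Ψ(0,β,p)` of a perturbation in the direction `β`. -/
def marginal (M : Market Ω) (P : Measure Ω) (U : ℝ → ℝ) (β p : ℝ≥0 → Ω → ℝ) (ω : Ω) : ℝ :=
  deriv U (M.terminalWealth P p ω) * M.terminalWealth P p ω * M.Psi P 0 β p ω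

/-- The logarithmic wealth lies below each of its linearizations. -/
theorem logWealth_le [IsProbabilityMeasure P] (hM : M.IsModel P)
    {p q β : ℝ≥0 → Ω → ℝ} (hp : M.IsAdmissible P p) (hq : M.IsAdmissible P q)
    (hβ : M.IsAdmissible P β) (hRβ : M.ForwardIntegrableNτ P (M.ratioField 0 β p)) {a : ℝ}
    (hlin : q = p + a • β) :
    ∀ᵐ ω ∂P, M.logWealth P q ω ≤ M.logWealth P p ω + a * M.Psi P 0 β p ω := by
  filter_upwards [logWealth_eq_sub_wealthGap hM hp hq hβ hβ hRβ hRβ (a := a) (b := 0)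
    (fun t ω => by simp [hlin])] with ω hω
  have := ENNReal.toReal_nonneg (a := M.wealthGap p q ω)
  linarith [hω.2]

/-- The expected marginal utility in a direction `c β` is non-positive at a local maximum: it is
the limit of the difference quotients of the expected utility, which are dominated between the
marginal utilities at `p` and at `p + cβ` by concavity. -/
theorem integral_marginal_nonpos [IsProbabilityMeasure P] (hM : M.IsModel P) {U : ℝ → ℝ}
    (hU : ∀ x, 0 < x → DifferentiableAt ℝ U x)
    (hconc : ConcaveOn ℝ univ fun x => U (Real.exp x))
    (hmono : StrictMono fun x => U (Real.exp x)) {p β : ℝ≥0 → Ω → ℝ}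
    (hp : M.IsAdmissible P p) (hβ : M.IsAdmissible P β)
    (hint : Integrable (fun ω => U (M.terminalWealth P p ω)) P) {δ c : ℝ}
    (hwell : M.WellDefinedNear P p β δ) (hc : |c| < δ)
    (habs : ∀ y : ℝ, |y| < δ → Integrable (fun ω =>
      deriv U (M.terminalWealth P (p + y • β) ω)
          * M.terminalWealth P (p + y • β) ω * |M.Psi P y β p ω|) P)
    (hmax : ∀ y : ℝ, |y| < δ →
      M.expectedUtility P U (p + y • β) ≤ M.expectedUtility P U p) :
    Integrable (fun ω => c * M.marginal P U β p ω) P ∧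
      ∫ ω, c * M.marginal P U β p ω ∂P ≤ 0 := by
  obtain ⟨V, hVdef⟩ : ∃ V : ℝ → ℝ, V = fun x => U (Real.exp x) := ⟨_, rfl⟩
  rw [← hVdef] at hconc hmono
  have hVX : ∀ q ω, U (M.terminalWealth P q ω) = V (M.logWealth P q ω) := fun q ω => by
    rw [terminalWealth_eq_exp hM, hVdef]
  have hVd : ∀ q ω, HasDerivAt V (deriv U (M.terminalWealth P q ω) * M.terminalWealth P q ω)
      (M.logWealth P q ω) := fun q ω => by
    rw [terminalWealth_eq_exp hM, hVdef]; exact hasDerivAt_comp_exp hU _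
  have hVd0 : ∀ q ω, 0 ≤ deriv U (M.terminalWealth P q ω) * M.terminalWealth P q ω :=
    fun q ω => (hVd q ω).deriv ▸ hmono.monotone.deriv_nonneg
  obtain ⟨s, hs⟩ : ∃ s : ℕ → ℝ, s = fun n : ℕ => 1 / ((n : ℝ) + 1) := ⟨_, rfl⟩
  have hs0 : ∀ n, 0 < s n := fun n => by rw [hs]; positivity
  have hs1 : ∀ n, s n ≤ 1 := fun n => by
    rw [hs]
    exact (div_le_one (by positivity)).2 (by have := n.cast_nonneg (α := ℝ); linarith)
  have hslim : Tendsto s atTop (𝓝 0) := by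
    rw [hs]; exact tendsto_one_div_add_atTop_nhds_zero_nat
  have hsc : ∀ n, |s n * c| < δ := fun n => by
    rw [abs_mul, abs_of_pos (hs0 n)]
    exact (mul_le_of_le_one_left (abs_nonneg c) (hs1 n)).trans_lt hc
  have hδ : |(0 : ℝ)| < δ := by rw [abs_zero]; exact (abs_nonneg c).trans_lt hc
  have hpc := (hwell c hc).1
  have hpn := fun n => (hwell _ (hsc n)).1
  have hR0 : M.ForwardIntegrableNτ P (M.ratioField 0 β p) := (hwell 0 hδ).2
  have hRc : M.ForwardIntegrableNτ P (M.ratioField 0 β (p + c • β)) := by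
    rw [← ratioField_eq_ratioField_zero]; exact (hwell c hc).2
  have hRn : ∀ n, M.ForwardIntegrableNτ P (M.ratioField 0 β (p + (s n * c) • β)) := fun n => by
    rw [← ratioField_eq_ratioField_zero]; exact (hwell _ (hsc n)).2
  have hI0 := habs 0 hδ
  have hIc := habs c hc
  rw [Psi_eq_Psi_zero] at hI0 hIc
  rw [zero_smul, add_zero] at hI0
  -- the difference quotients
  obtain ⟨Q, hQ⟩ : ∃ Q : ℕ → Ω → ℝ, Q = fun n ω =>
      (V (M.logWealth P (p + (s n * c) • β) ω) - V (M.logWealth P p ω)) / s n := ⟨_, rfl⟩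
  have hQm : ∀ n, AEStronglyMeasurable (Q n) P := fun n => by
    rw [hQ]
    exact (((hmono.monotone.measurable.comp_aemeasurable (aemeasurable_logWealth hM (hpn n))).sub
      (hmono.monotone.measurable.comp_aemeasurable
        (aemeasurable_logWealth hM hp))).div_const _).aestronglyMeasurable
  obtain ⟨B, hB⟩ : ∃ B : Ω → ℝ, B = fun ω =>
      |c| * (deriv U (M.terminalWealth P p ω) * M.terminalWealth P p ω * |M.Psi P 0 β p ω|)
      + |c| * (deriv U (M.terminalWealth P (p + c • β) ω) * M.terminalWealth P (p + c • β) ω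
        * |M.Psi P 0 β (p + c • β) ω|) := ⟨_, rfl⟩
  have hBint : Integrable B P := by
    rw [hB]; exact (hI0.const_mul _).add (hIc.const_mul _)
  -- three supergradient inequalities give the concavity of the logarithmic wealth along `p + yβ`
  have hQB : ∀ n, ∀ᵐ ω ∂P, ‖Q n ω‖ ≤ B ω := by
    intro n
    filter_upwards [logWealth_le hM hp (hpn n) hβ hR0 rfl,
      logWealth_le hM (hpn n) hp hβ (hRn n) (a := -(s n * c)) (by
        rw [neg_smul]; exact (add_neg_cancel_right _ _).symm),
      logWealth_le hM (hpn n) hpc hβ (hRn n) (a := c - s n * c) (by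
        rw [sub_smul, add_assoc, add_sub_cancel]),
      logWealth_le hM hpc hp hβ hRc (a := -c) (by
        rw [neg_smul]; exact (add_neg_cancel_right _ _).symm)] with ω h1 h2 h3 h4
    have hs0n := hs0 n
    have hs1n := hs1 n
    set ℓ0 := M.logWealth P p ω
    set ℓc := M.logWealth P (p + c • β) ω
    set ℓn := M.logWealth P (p + (s n * c) • β) ω
    set v0 := deriv U (M.terminalWealth P p ω) * M.terminalWealth P p ω
    set vc := deriv U (M.terminalWealth P (p + c • β) ω) * M.terminalWealth P (p + c • β) ω
    have hup : Q n ω ≤ v0 * (c * M.Psi P 0 β p ω) := by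
      rw [hQ, div_le_iff₀ hs0n]
      have e1 := hconc.le_add_mul_of_hasDerivAt (hVd p ω) ℓn
      have e2 : v0 * (ℓn - ℓ0) ≤ v0 * (s n * c * M.Psi P 0 β p ω) :=
        mul_le_mul_of_nonneg_left (by linarith) (hVd0 p ω)
      linarith
    have hlow : vc * (c * M.Psi P 0 β (p + c • β) ω) ≤ Q n ω := by
      rw [hQ, le_div_iff₀ hs0n]
      have e0 : (1 - s n) * ℓ0 + s n * ℓc ≤ ℓn := by
        nlinarith [mul_le_mul_of_nonneg_left h2 (sub_nonneg.2 hs1n),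
          mul_le_mul_of_nonneg_left h3 hs0n.le]
      have e1 := hconc.2 (mem_univ ℓ0) (mem_univ ℓc) (sub_nonneg.2 hs1n) hs0n.le (by ring)
      simp only [smul_eq_mul] at e1
      have e2 := hmono.monotone e0
      have e3 := hconc.le_add_mul_of_hasDerivAt (hVd (p + c • β) ω) ℓ0
      have e4 : vc * (ℓ0 - ℓc) ≤ vc * (-c * M.Psi P 0 β (p + c • β) ω) :=
        mul_le_mul_of_nonneg_left (by linarith) (hVd0 _ ω)
      have e5 : vc * (c * M.Psi P 0 β (p + c • β) ω) ≤ V ℓc - V ℓ0 := by linarith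
      nlinarith [mul_le_mul_of_nonneg_left e5 hs0n.le]
    have b0 : |v0 * (c * M.Psi P 0 β p ω)| = |c| * (v0 * |M.Psi P 0 β p ω|) := by
      rw [abs_mul v0, abs_mul c, abs_of_nonneg (hVd0 p ω)]; ring
    have bc : |vc * (c * M.Psi P 0 β (p + c • β) ω)|
        = |c| * (vc * |M.Psi P 0 β (p + c • β) ω|) := by
      rw [abs_mul vc, abs_mul c, abs_of_nonneg (hVd0 (p + c • β) ω)]; ring
    have hBω : B ω = |c| * (v0 * |M.Psi P 0 β p ω|)
        + |c| * (vc * |M.Psi P 0 β (p + c • β) ω|) := by rw [hB]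
    rw [Real.norm_eq_abs, hBω, ← b0, ← bc, abs_le]
    constructor
    · linarith [neg_abs_le (vc * (c * M.Psi P 0 β (p + c • β) ω)),
        abs_nonneg (v0 * (c * M.Psi P 0 β p ω))]
    · linarith [le_abs_self (v0 * (c * M.Psi P 0 β p ω)),
        abs_nonneg (vc * (c * M.Psi P 0 β (p + c • β) ω))]
  have hQlim : ∀ᵐ ω ∂P, Tendsto (fun n => Q n ω) atTop (𝓝 (c * M.marginal P U β p ω)) := by
    have hg1 := logWealth_eq_sub_wealthGap hM hp hpc hβ hβ hR0 hR0 (a := c) (b := 0)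
      (fun t ω => by simp)
    have hgn := ae_all_iff.2 fun n => logWealth_eq_sub_wealthGap hM hp (hpn n) hβ hβ hR0 hR0
      (a := s n * c) (b := 0) (fun t ω => by simp)
    filter_upwards [hgn, tendsto_wealthGap_div hM hp hpc (hg1.mono fun ω h => h.1) hs0 hs1 hslim]
      with ω h1 h2
    have h3 : Tendsto (fun n => (M.logWealth P (p + (s n * c) • β) ω - M.logWealth P p ω) / s n)
        atTop (𝓝 (c * M.Psi P 0 β p ω)) := by
      have h4 := h2.const_sub (c * M.Psi P 0 β p ω)
      rw [sub_zero] at h4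
      refine h4.congr fun n => ?_
      rw [(h1 n).2, add_sub_cancel_left, smul_smul]
      have := (hs0 n).ne'
      field_simp
      ring
    have h5 := (hVd p ω).tendsto_div_of_tendsto_div (fun n => (hs0 n).ne') hslim h3
    rw [hQ, marginal]
    convert h5 using 2
    ring
  have hDm := aestronglyMeasurable_of_tendsto_ae atTop hQm hQlim
  have hQint : ∀ n, Integrable (Q n) P := fun n => hBint.mono' (hQm n) (hQB n)
  refine ⟨hBint.mono' hDm ?_, ?_⟩
  · filter_upwards [hQlim, ae_all_iff.2 hQB] with ω h1 h2
    exact le_of_tendsto' h1.norm h2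
  · refine le_of_tendsto' (tendsto_integral_of_dominated_convergence B hQm hBint hQB hQlim)
      fun n => ?_
    have hgn : (fun ω => U (M.terminalWealth P (p + (s n * c) • β) ω))
        = fun ω => U (M.terminalWealth P p ω) + s n * Q n ω := by
      funext ω
      have := (hs0 n).ne'
      rw [hVX, hVX, hQ]
      field_simp
      ring
    have hgi : Integrable (fun ω => U (M.terminalWealth P (p + (s n * c) • β) ω)) P := by
      rw [hgn]; exact hint.add ((hQint n).const_mul _)
    have h := hmax _ (hsc n)
    rw [expectedUtility_eq_integral hint, expectedUtility_eq_integral hgi, EReal.coe_le_coe_iff,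
      hgn, integral_add hint ((hQint n).const_mul _), integral_const_mul] at h
    have h' : s n * ∫ ω, Q n ω ∂P ≤ s n * 0 := by linarith
    exact le_of_mul_le_mul_left h' (hs0 n)

/-- First order condition at a local maximum: the step `c` can be taken in both directions. -/
theorem integral_marginal_eq_zero [IsProbabilityMeasure P] (hM : M.IsModel P) {U : ℝ → ℝ}
    (hU : ∀ x, 0 < x → DifferentiableAt ℝ U x)
    (hconc : ConcaveOn ℝ univ fun x => U (Real.exp x))
    (hmono : StrictMono fun x => U (Real.exp x)) {p β : ℝ≥0 → Ω → ℝ}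
    (hui : M.AssumptionUI P U p) (hmax : M.IsLocalMaximum P U p)
    (hβ : M.IsAdmissible P β) (hbdd : M.IsBddPortfolio P β) :
    M.ForwardIntegrableNτ P (M.ratioField 0 β p) ∧ Integrable (M.marginal P U β p) P ∧
      ∫ ω, M.marginal P U β p ω ∂P = 0 := by
  obtain ⟨δ₁, hδ₁, hwell, hunif⟩ := hui.unif β hβ hbdd
  obtain ⟨δ₂, hδ₂, hloc⟩ := hmax.2 β hβ hbdd
  obtain ⟨c, hc0, hc⟩ := exists_between (lt_min hδ₁ hδ₂)
  have key : ∀ e : ℝ, |e| = c → _ := fun e he =>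
    integral_marginal_nonpos hM hU hconc hmono hmax.1 hβ hui.integrable (δ := min δ₁ δ₂) (c := e)
      (fun y hy => hwell y (hy.trans_le (min_le_left _ _))) (by rw [he]; exact hc)
      (fun y hy => memLp_one_iff_integrable.1
        (hunif.memLp ⟨y, abs_lt.1 (hy.trans_le (min_le_left _ _))⟩))
      (fun y hy => hloc y (hy.trans_le (min_le_right _ _))
        (hwell y (hy.trans_le (min_le_left _ _))).1)
  have h1 := key c (abs_of_pos hc0)
  have h2 := key (-c) (by rw [abs_neg, abs_of_pos hc0])
  rw [integral_const_mul] at h1 h2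
  refine ⟨(hwell 0 (by rwa [abs_zero])).2, ?_, ?_⟩
  · have := h1.1.const_mul c⁻¹
    refine this.congr (Eventually.of_forall fun ω => ?_)
    simp only
    rw [inv_mul_cancel_left₀ hc0.ne']
  · nlinarith [h1.2, h2.2]

/-! ### Two local maxima have no concavity gap -/

/-- Half of the comparison of two critical portfolios: the utility of `q` lies below the
linearization of the utility at `p`, whose expectation is the expected utility of `p`. Equality of
the expected utilities forces the gap to vanish. -/
theorem integral_utility_le_of_marginal_eq_zero [IsProbabilityMeasure P] (hM : M.IsModel P)
    {U : ℝ → ℝ} (hU : ∀ x, 0 < x → DifferentiableAt ℝ U x)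
    (hconc : ConcaveOn ℝ univ fun x => U (Real.exp x))
    (hmono : StrictMono fun x => U (Real.exp x)) {p q : ℝ≥0 → Ω → ℝ}
    (hp : M.IsAdmissible P p) (hq : M.IsAdmissible P q)
    (hRp : M.ForwardIntegrableNτ P (M.ratioField 0 p p))
    (hRq : M.ForwardIntegrableNτ P (M.ratioField 0 q p))
    (hIp : Integrable (M.marginal P U p p) P) (hIq : Integrable (M.marginal P U q p) P)
    (h0p : ∫ ω, M.marginal P U p p ω ∂P = 0) (h0q : ∫ ω, M.marginal P U q p ω ∂P = 0)
    (hUp : Integrable (fun ω => U (M.terminalWealth P p ω)) P)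
    (hUq : Integrable (fun ω => U (M.terminalWealth P q ω)) P) :
    ∫ ω, U (M.terminalWealth P q ω) ∂P ≤ ∫ ω, U (M.terminalWealth P p ω) ∂P ∧
    (∫ ω, U (M.terminalWealth P q ω) ∂P = ∫ ω, U (M.terminalWealth P p ω) ∂P →
      ∀ᵐ ω ∂P, M.wealthGap p q ω = 0) := by
  have hgap := logWealth_eq_sub_wealthGap hM hp hq hq hp hRq hRp (a := 1) (b := -1)
    (fun t ω => by ring)
  have hlin : ∀ ω, U (Real.exp (M.logWealth P p ω + (M.Psi P 0 q p ω - M.Psi P 0 p p ω)))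
      ≤ U (M.terminalWealth P p ω) + (M.marginal P U q p ω - M.marginal P U p p ω) := by
    intro ω
    have h := hconc.le_add_mul_of_hasDerivAt (hasDerivAt_comp_exp hU (M.logWealth P p ω))
      (M.logWealth P p ω + (M.Psi P 0 q p ω - M.Psi P 0 p p ω))
    rw [← terminalWealth_eq_exp hM] at h
    refine h.trans (le_of_eq ?_)
    rw [marginal, marginal]
    ring
  have hle : ∀ᵐ ω ∂P, U (M.terminalWealth P q ω)
      ≤ U (M.terminalWealth P p ω) + (M.marginal P U q p ω - M.marginal P U p p ω) := by
    filter_upwards [hgap] with ω hω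
    refine le_trans ?_ (hlin ω)
    rw [terminalWealth_eq_exp hM]
    refine hmono.monotone ?_
    have := ENNReal.toReal_nonneg (a := M.wealthGap p q ω)
    linarith [hω.2]
  have hI : Integrable (fun ω => M.marginal P U q p ω - M.marginal P U p p ω) P := hIq.sub hIp
  have hIR : Integrable (fun ω => U (M.terminalWealth P p ω)
      + (M.marginal P U q p ω - M.marginal P U p p ω)) P := hUp.add hI
  have hR : ∫ ω, (U (M.terminalWealth P p ω)
      + (M.marginal P U q p ω - M.marginal P U p p ω)) ∂P
      = ∫ ω, U (M.terminalWealth P p ω) ∂P := by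
    rw [integral_add hUp hI, integral_sub hIq hIp, h0p, h0q]
    ring
  refine ⟨hR ▸ integral_mono_ae hUq hIR hle, fun heq => ?_⟩
  have hae := (integral_eq_iff_of_ae_le hUq hIR hle).1 (heq.trans hR.symm)
  filter_upwards [hae, hgap] with ω h1 h2
  -- strict monotonicity of the utility turns equality of utilities into equality of wealths
  have h3 : U (Real.exp (M.logWealth P p ω + (M.Psi P 0 q p ω - M.Psi P 0 p p ω)))
      ≤ U (Real.exp (M.logWealth P q ω)) := by
    rw [← terminalWealth_eq_exp hM q ω, h1]
    exact hlin ω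
  have h4 := hmono.le_iff_le.1 h3
  have h5 : (M.wealthGap p q ω).toReal = 0 :=
    le_antisymm (by linarith [h2.2]) ENNReal.toReal_nonneg
  exact ((ENNReal.toReal_eq_zero_iff _).1 h5).resolve_right h2.1.ne

/-! ### Noise on stochastic intervals -/

/-- The first time in a countable set after `a` (and before `T`) at which `|d| ≤ ε`. -/
def firstSmall (T : ℝ≥0) (u : ℕ → ℝ≥0) (d : ℝ≥0 → Ω → ℝ) (a : ℝ≥0) (ε : ℝ) (ω : Ω) :
    WithTop ℝ≥0 :=
  open Classical in ⨅ k, if a < u k ∧ u k ≤ T ∧ |d (u k) ω| ≤ ε then (u k : WithTop ℝ≥0) else ⊤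

/-- Right continuity of the filtration is needed, as the infimum is not attained in general. -/
theorem isStoppingTime_firstSmall {G : Filtration ℝ≥0 mΩ} [G.IsRightContinuous] {T : ℝ≥0}
    (u : ℕ → ℝ≥0) {d : ℝ≥0 → Ω → ℝ} (hd : ∀ t ≤ T, Measurable[G t] (d t)) (a : ℝ≥0) (ε : ℝ) :
    IsStoppingTime G (firstSmall T u d a ε) := by
  classical
  refine IsStoppingTime.iInf fun k t => ?_
  by_cases h : a < u k ∧ u k ≤ T ∧ u k ≤ t
  · have hset : {ω | (if a < u k ∧ u k ≤ T ∧ |d (u k) ω| ≤ ε then (u k : WithTop ℝ≥0) else ⊤)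
        ≤ (t : WithTop ℝ≥0)} = {ω | |d (u k) ω| ≤ ε} := by
      ext ω
      change (if a < u k ∧ u k ≤ T ∧ |d (u k) ω| ≤ ε then (u k : WithTop ℝ≥0) else ⊤)
        ≤ (t : WithTop ℝ≥0) ↔ |d (u k) ω| ≤ ε
      split_ifs with h'
      · exact iff_of_true (WithTop.coe_le_coe.2 h.2.2) h'.2.2
      · exact iff_of_false (not_le.2 (WithTop.coe_lt_top t)) fun h'' => h' ⟨h.1, h.2.1, h''⟩
    rw [hset]
    refine G.mono h.2.2 _ ?_
    have h1 : Measurable[G (u k)] (abs ∘ d (u k)) := measurable_abs.comp (hd _ h.2.1)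
    exact h1 measurableSet_Iic
  · have hset : {ω | (if a < u k ∧ u k ≤ T ∧ |d (u k) ω| ≤ ε then (u k : WithTop ℝ≥0) else ⊤)
        ≤ (t : WithTop ℝ≥0)} = ∅ := by
      refine eq_empty_of_forall_notMem fun ω hω => h ?_
      change (if a < u k ∧ u k ≤ T ∧ |d (u k) ω| ≤ ε then (u k : WithTop ℝ≥0) else ⊤)
        ≤ (t : WithTop ℝ≥0) at hω
      split_ifs at hω with h'
      · exact ⟨h'.1, h'.2.1, WithTop.coe_le_coe.1 hω⟩
      · exact absurd hω (not_le.2 (WithTop.coe_lt_top t))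
    rw [hset]
    exact @MeasurableSet.empty _ (G t)

/-- There is no noise on an interval where `d` does not vanish, if `d` vanishes wherever there is
noise. -/
theorem noise_eq_zero {d : ℝ≥0 → Ω → ℝ} {ω : Ω} {s t : ℝ≥0} (hsub : Ioc s t ⊆ Ioc 0 (M.τ ω))
    (hσ : ∀ᵐ t ∂leb.restrict (Ioc 0 (M.τ ω)), M.σ t ω ≠ 0 → d t ω = 0)
    (hθ : ∀ᵐ x ∂(M.N ω).restrict (Ioc 0 (M.τ ω) ×ˢ ({0}ᶜ : Set ℝ)),
      M.θ x.1 x.2 ω ≠ 0 → d x.1 ω = 0)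
    (hκ : ∀ t ∈ Ioc 0 (M.τ ω), M.κ t ω * jump (M.H · ω) t ≠ 0 → d t ω = 0)
    (hd : ∀ r ∈ Ioc s t, d r ω ≠ 0) : M.noise s t ω = 0 := by
  have h1 : ∫⁻ r in Ioc s t, ENNReal.ofReal (M.σ r ω ^ 2) ∂leb = 0 := by
    refine (lintegral_congr_ae ?_).trans lintegral_zero
    filter_upwards [ae_restrict_of_ae_restrict_of_subset hsub hσ,
      ae_restrict_mem measurableSet_Ioc] with r hr hrm
    have : M.σ r ω = 0 := by_contra fun h => hd r hrm (hr h)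
    simp [this]
  have h2 : ∫⁻ p in Ioc s t ×ˢ ({0}ᶜ : Set ℝ), ENNReal.ofReal (M.θ p.1 p.2 ω ^ 2) ∂(M.N ω)
      = 0 := by
    refine (lintegral_congr_ae ?_).trans lintegral_zero
    filter_upwards [ae_restrict_of_ae_restrict_of_subset (prod_mono hsub le_rfl) hθ,
      ae_restrict_mem (measurableSet_Ioc.prod (measurableSet_singleton 0).compl)] with x hx hxm
    have : M.θ x.1 x.2 ω = 0 := by_contra fun h => hd x.1 hxm.1 (hx h)
    simp [this]
  have h3 : jumpInt (M.H · ω) (fun r => M.κ r ω ^ 2) s t = 0 := by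
    refine finsum_mem_eq_zero_of_forall_eq_zero fun r hr => ?_
    have h : M.κ r ω * jump (M.H · ω) r = 0 :=
      by_contra fun h => hd r hr (hκ r (hsub hr) h)
    simp only [sq, mul_assoc, h, mul_zero]
  rw [noise, h1, h2, h3]
  simp

/-- A process that vanishes wherever there is noise vanishes up to `τ`: otherwise it would stay
away from zero on a non-empty stochastic interval without noise. -/
theorem eq_zero_of_nondegenerate (hM : M.IsModel P) (hnd : M.Nondegenerate P)
    {d : ℝ≥0 → Ω → ℝ} (hcag : ∀ᵐ ω ∂P, IsCaglad M.T (d · ω))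
    (hadapt : ∀ t ≤ M.T, Measurable[M.G t] (d t))
    (h : ∀ᵐ ω ∂P, (∀ᵐ t ∂leb.restrict (Ioc 0 (M.τ ω)), M.σ t ω ≠ 0 → d t ω = 0) ∧
      (∀ᵐ x ∂(M.N ω).restrict (Ioc 0 (M.τ ω) ×ˢ ({0}ᶜ : Set ℝ)),
        M.θ x.1 x.2 ω ≠ 0 → d x.1 ω = 0) ∧
      ∀ t ∈ Ioc 0 (M.τ ω), M.κ t ω * jump (M.H · ω) t ≠ 0 → d t ω = 0) :
    ∀ᵐ ω ∂P, ∀ t ∈ Ioc 0 (M.τ ω), d t ω = 0 := by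
  classical
  have hrc := hM.right_continuous
  obtain ⟨u, hu⟩ : ∃ u : ℕ → ℝ≥0, DenseRange u := TopologicalSpace.exists_dense_seq _
  -- `S' i n` ends the interval that starts at `min (u i) τ` and on which `|d| ≥ 1 / (n + 1)`
  let R : ℕ → ℕ → Ω → WithTop ℝ≥0 := fun i n => firstSmall M.T u d (u i) (1 / ((n : ℝ) + 1))
  have hRge : ∀ i n ω, (u i : WithTop ℝ≥0) ≤ R i n ω := fun i n ω => le_iInf fun k => by
    split_ifs with hk
    · exact WithTop.coe_le_coe.2 hk.1.le
    · exact le_top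
  let S' : ℕ → ℕ → Ω → ℝ≥0 := fun i n ω => (min (M.τ ω : WithTop ℝ≥0) (R i n ω)).untopD 0
  have hS' : ∀ i n ω, (S' i n ω : WithTop ℝ≥0) = min (M.τ ω : WithTop ℝ≥0) (R i n ω) :=
    fun i n ω => by
      obtain ⟨x, hx⟩ := WithTop.ne_top_iff_exists.1
        (ne_top_of_le_ne_top WithTop.coe_ne_top
          (min_le_left (M.τ ω : WithTop ℝ≥0) (R i n ω)))
      simp only [S']
      rw [← hx, WithTop.untopD_coe]
  have hall : ∀ᵐ ω ∂P, ∀ i n, min (u i) (M.τ ω) = S' i n ω := by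
    refine ae_all_iff.2 fun i => ae_all_iff.2 fun n => ?_
    refine hnd (fun ω => min (u i) (M.τ ω)) (S' i n) ?_ ?_ (fun ω => ⟨?_, ?_⟩) ?_
    · have := (isStoppingTime_const M.G (u i)).min hM.τ_stopping
      simpa only [WithTop.coe_min] using this
    · simp only [hS']
      exact hM.τ_stopping.min (isStoppingTime_firstSmall u hadapt _ _)
    · rw [← WithTop.coe_le_coe, hS', WithTop.coe_min]
      exact le_min (min_le_right _ _) ((min_le_left _ _).trans (hRge i n ω))
    · rw [← WithTop.coe_le_coe, hS']
      exact min_le_left _ _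
    · filter_upwards [h, hcag] with ω hω hc
      have hle : S' i n ω ≤ M.τ ω := by
        rw [← WithTop.coe_le_coe, hS']; exact min_le_left _ _
      refine noise_eq_zero (Ioc_subset_Ioc zero_le hle) hω.1 hω.2.1 hω.2.2 fun t ht hdt => ?_
      have htτ : t ≤ M.τ ω := ht.2.trans hle
      have hut : u i < t := by
        rcases min_lt_iff.1 ht.1 with h' | h'
        · exact h'
        · exact absurd htτ (not_le.2 h')
      have ht0 : 0 < t := zero_le.trans_lt hut
      -- by left continuity `|d|` is small shortly before `t`, against the choice of `S'`
      have hev : ∀ᶠ s in 𝓝[<] t, |d s ω| < 1 / ((n : ℝ) + 1) := by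
        have h1 := (hc.1 t ht0 (htτ.trans (hM.τ_le ω))).tendsto.abs
        rw [hdt, abs_zero] at h1
        exact h1.eventually (gt_mem_nhds (by positivity))
      obtain ⟨l, hl, hlt⟩ := (mem_nhdsLT_iff_exists_Ioo_subset' ht0).1 hev
      obtain ⟨k, hk⟩ := hu.exists_mem_open isOpen_Ioo
        (nonempty_Ioo.2 (max_lt hl hut))
      have hk1 : u k ∈ Ioo l t := ⟨(le_max_left _ _).trans_lt hk.1, hk.2⟩
      have hk2 : u i < u k := (le_max_right _ _).trans_lt hk.1
      have hRk : R i n ω ≤ u k := by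
        refine (iInf_le _ k).trans (le_of_eq (if_pos ⟨hk2, ?_, (hlt hk1).le⟩))
        exact (hk1.2.le.trans htτ).trans (hM.τ_le ω)
      have h2 : (t : WithTop ℝ≥0) ≤ u k := by
        refine (WithTop.coe_le_coe.2 ht.2).trans ?_
        rw [hS']
        exact (min_le_right _ _).trans hRk
      exact absurd (WithTop.coe_le_coe.1 h2) (not_le.2 hk1.2)
  filter_upwards [hall, hcag] with ω hω hc t ht
  by_contra hdt
  obtain ⟨n, hn⟩ := exists_nat_one_div_lt (abs_pos.2 hdt)
  have hev : ∀ᶠ s in 𝓝[<] t, 1 / ((n : ℝ) + 1) < |d s ω| :=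
    (hc.1 t ht.1 (ht.2.trans (hM.τ_le ω))).tendsto.abs.eventually (lt_mem_nhds hn)
  obtain ⟨l, hl, hlt⟩ := (mem_nhdsLT_iff_exists_Ioo_subset' ht.1).1 hev
  obtain ⟨i, hi⟩ := hu.exists_mem_open isOpen_Ioo (nonempty_Ioo.2 hl)
  have hRt : (t : WithTop ℝ≥0) ≤ R i n ω := le_iInf fun k => by
    split_ifs with hk
    · refine WithTop.coe_le_coe.2 (le_of_not_gt fun hkt => ?_)
      exact absurd hk.2.2 (not_le.2 (hlt ⟨hi.1.trans hk.1, hkt⟩))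
    · exact le_top
  have h1 : (t : WithTop ℝ≥0) ≤ S' i n ω := by
    rw [hS']
    exact le_min (WithTop.coe_le_coe.2 ht.2) hRt
  have h2 := WithTop.coe_le_coe.1 h1
  rw [← hω i n] at h2
  exact absurd (h2.trans (min_le_left _ _)) (not_le.2 hi.2)

end Market

end ForwardMarket

end

theorem mainTheorem4 {Ω : Type*} [MeasurableSpace Ω] (P : MeasureTheory.Measure Ω)
    [MeasureTheory.IsProbabilityMeasure P] (M : ForwardMarket.Market Ω) (hM : M.IsModel P)
    (hnd : M.Nondegenerate P) (U : ℝ → ℝ) (A : Set (ℝ≥0 → Ω → ℝ))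
    (hA : A ⊆ M.admissible P) (hconv : Convex ℝ A)
    (hbdd : ∀ π ∈ A, M.IsBddPortfolio P π)
    (hui : ∀ π ∈ A, M.AssumptionUI P U π)
    (hd2 : ∀ π ∈ A, M.AssumptionD2 P U π)
    (hU : ∀ x : ℝ, 0 < x → x * deriv (deriv U) x + deriv U x ≤ 0)
    (π₁ π₂ : ℝ≥0 → Ω → ℝ) (h₁ : π₁ ∈ A) (h₂ : π₂ ∈ A)
    (hmax₁ : M.IsLocalMaximum P U π₁) (hmax₂ : M.IsLocalMaximum P U π₂) :
    ∀ᵐ ω ∂P, ∀ t ∈ Set.Ioc 0 (M.τ ω), π₁ t ω = π₂ t ω := by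
  have hdiff := (hd2 π₁ h₁).differentiable
  have hconc := ForwardMarket.concaveOn_comp_exp hdiff (hd2 π₁ h₁).differentiable_deriv hU
  have hmono := ForwardMarket.strictMono_comp_exp (hd2 π₁ h₁).strictMono
  have hfirst : ∀ π ∈ A, M.IsLocalMaximum P U π → ∀ β ∈ A, _ := fun π hπ hmax β hβ =>
    ForwardMarket.Market.integral_marginal_eq_zero hM hdiff hconc hmono (hui π hπ) hmax (hA hβ)
      (hbdd β hβ)
  obtain ⟨hR11, hI11, h011⟩ := hfirst π₁ h₁ hmax₁ π₁ h₁
  obtain ⟨hR12, hI12, h012⟩ := hfirst π₁ h₁ hmax₁ π₂ h₂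
  obtain ⟨hR21, hI21, h021⟩ := hfirst π₂ h₂ hmax₂ π₁ h₁
  obtain ⟨hR22, hI22, h022⟩ := hfirst π₂ h₂ hmax₂ π₂ h₂
  have hU1 := (hui π₁ h₁).integrable
  have hU2 := (hui π₂ h₂).integrable
  obtain ⟨hle, hgap⟩ := ForwardMarket.Market.integral_utility_le_of_marginal_eq_zero hM hdiff hconc
    hmono (hA h₁) (hA h₂) hR11 hR12 hI11 hI12 h011 h012 hU1 hU2
  obtain ⟨hge, -⟩ := ForwardMarket.Market.integral_utility_le_of_marginal_eq_zero hM hdiff hconc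
    hmono (hA h₂) (hA h₁) hR22 hR21 hI22 hI21 h022 h021 hU2 hU1
  have hnoise := ForwardMarket.Market.eq_of_wealthGap_eq_zero hM (hA h₁) (hA h₂)
    (hgap (le_antisymm hle hge))
  have hzero := ForwardMarket.Market.eq_zero_of_nondegenerate hM hnd
    (d := fun t ω => π₁ t ω - π₂ t ω)
    (by
      filter_upwards [(hA h₁).caglad, (hA h₂).caglad] with ω h1 h2 using h1.sub h2)
    (fun t ht => ((hA h₁).adapted t ht).sub ((hA h₂).adapted t ht))
    (by simpa only [sub_eq_zero] using hnoise)
  simpa only [sub_eq_zero] using hzero
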